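/- Let $m\ge 1$ and let $\mathcal{C}\ell_{0,m}^c=\mathbb{C}\otimes\mathcal{C}\ell_{0,m}$ be the complexified Clifford algebra with generators $e_1,\dots,e_m$, $e_je_k+e_ke_j=-2\delta_{jk}$; identify $x\in\mathbb{R}^m$ with $\sum_j e_jx_j$, and write $(x,y)=\sum_j x_jy_j$. Let $$\Gamma_y=-\sum_{j<k}e_je_k\,(y_j\partial_{y_k}-y_k\partial_{y_j})$$ act on $\mathcal{C}\ell_{0,m}^c$-valued functions of $y\in\mathbb{R}^m$. As $\Gamma_y$ preserves the finite-dimensional space of homogeneous polynomials of each degree, define $$e^{i\frac{\pi}{2}\Gamma_y^2}f=\sum_{k=0}^\infty\sum_{n=0}^\infty\frac{1}{n!}\Bigl(i\tfrac{\pi}{2}\Gamma_y^2\Bigr)^n f_k ,$$ where $f_k$ is the homogeneous component of degree $k$ of the Taylor expansion of $f$ at $0$. Let $x,y\in\mathbb{R}^m$. Then for every $t\in\mathbb{R}$ the series defining $e^{i\frac{\pi}{2}\Gamma_y^2}e^{-it(x,y)}$ converge absolutely (for each $k$ the series over $n$, and then the series over $k$), and for every $s\in\mathbb{C}$ with $\mathrm{Re}\,s>0$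 the function $t\mapsto e^{-st}\,t^{m/2-1}e^{i\frac{\pi}{2}\Gamma_y^2}e^{-it(x,y)}$ is integrable on $(0,\infty)$ and $$\int_0^\infty e^{-st}\,t^{m/2-1}e^{i\frac{\pi}{2}\Gamma_y^2}e^{-it(x,y)}\,dt=\frac{\Gamma(m/2)}{4\sqrt{+}}\Bigl((1+i)U^1_m+(1-i)U^2_m+e^{i\frac{\pi}{2}(m-1)^2}\bigl((1+i)U^3_m+(1-i)U^4_m\bigr)\Bigr),$$ where $\sqrt{+}=\sqrt{s^2+|x|^2|y|^2}$ and $$U^1_m=\frac{s+\sqrt{+}-iyx}{(s+i(x,y))^{m/2}},\qquad U^2_m=\frac{s+\sqrt{+}+iyx}{(s-i(x,y))^{m/2}},$$ $$U^3_m=\frac{(-1)^{m-1}(\sqrt{+}-s)+iyx}{(s+(-1)^{m-1}i(x,y))^{m/2}},\qquad U^4_m=\frac{(-1)^{m-1}(s-\sqrt{+})+iyx}{(s-(-1)^{m-1}i(x,y))^{m/2}},$$ with $yx$ the Clifford product and principal branches of the square root and of the powers. -/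

import Mathlib

open scoped TensorProduct

noncomputable section

/-- The quadratic form `x ↦ -|x|²` on `ℝᵐ`, so that `e_i e_j + e_j e_i = -2 δ_ij`. -/
def cliffordForm (m : ℕ) : QuadraticForm ℝ (EuclideanSpace ℝ (Fin m)) :=
  -LinearMap.BilinMap.toQuadraticMap (innerₗ (EuclideanSpace ℝ (Fin m)))

/-- The complexified Clifford algebra `ℂ ⊗ Cℓ_{0,m}`. -/
def ComplexClifford (m : ℕ) : Type := ℂ ⊗[ℝ] CliffordAlgebra (cliffordForm m)

namespace ComplexClifford

instance instRing (m : ℕ) : Ring (ComplexClifford m) :=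
  inferInstanceAs (Ring (ℂ ⊗[ℝ] CliffordAlgebra (cliffordForm m)))

instance instAlgebra (m : ℕ) : Algebra ℂ (ComplexClifford m) :=
  inferInstanceAs (Algebra ℂ (ℂ ⊗[ℝ] CliffordAlgebra (cliffordForm m)))

/-- The basis `(e_A)`, `A ⊆ {1, …, m}`, of the complexified Clifford algebra, transported from the
exterior algebra. -/
def basis (m : ℕ) : Module.Basis (Finset (Fin m)) ℂ (ComplexClifford m) :=
  ((EuclideanSpace.basisFun (Fin m) ℝ).toBasis.ExteriorAlgebra.map
    (CliffordAlgebra.equivExterior (cliffordForm m)).symm).baseChange ℂ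

/-- The coordinates with respect to `(e_A)`, as a vector of a finite-dimensional Hilbert space. -/
def coords (m : ℕ) : ComplexClifford m ≃ₗ[ℂ] EuclideanSpace ℂ (Finset (Fin m)) :=
  (basis m).equivFun.trans (WithLp.linearEquiv 2 ℂ (Finset (Fin m) → ℂ)).symm

/-- The norm `|a|² = ∑_A |a_A|²` on the (finite-dimensional) complexified Clifford algebra. -/
instance instNormedAddCommGroup (m : ℕ) : NormedAddCommGroup (ComplexClifford m) :=
  NormedAddCommGroup.induced _ _ (coords m) (coords m).injective

instance instNormedSpace (m : ℕ) : NormedSpace ℂ (ComplexClifford m) :=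
  NormedSpace.induced ℂ _ _ (coords m)

instance instFiniteDimensional (m : ℕ) : FiniteDimensional ℂ (ComplexClifford m) :=
  (basis m).finiteDimensional_of_finite

/-- The embedding of vectors, `x ↦ ∑_j e_j x_j`. -/
def vec {m : ℕ} (x : EuclideanSpace ℝ (Fin m)) : ComplexClifford m :=
  (1 : ℂ) ⊗ₜ[ℝ] CliffordAlgebra.ι (cliffordForm m) x

/-- The basis vector `e_j` as an element of the Clifford algebra. -/
def e {m : ℕ} (j : Fin m) : ComplexClifford m := vec (EuclideanSpace.single j 1)

/-- The defining relation `x² = -|x|²`. -/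
theorem vec_mul_self {m : ℕ} (x : EuclideanSpace ℝ (Fin m)) :
    vec x * vec x = algebraMap ℂ (ComplexClifford m) (-((‖x‖ : ℂ) ^ 2)) := by
  have h : (1 : ℂ) ⊗ₜ[ℝ] CliffordAlgebra.ι (cliffordForm m) x
      * (1 : ℂ) ⊗ₜ[ℝ] CliffordAlgebra.ι (cliffordForm m) x
      = algebraMap ℂ (ℂ ⊗[ℝ] CliffordAlgebra (cliffordForm m)) (-((‖x‖ : ℂ) ^ 2)) := by
    rw [Algebra.TensorProduct.tmul_mul_tmul, CliffordAlgebra.ι_sq_scalar,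
      Algebra.algebraMap_eq_smul_one, TensorProduct.tmul_smul, TensorProduct.smul_tmul',
      Algebra.TensorProduct.algebraMap_apply]
    simp [cliffordForm]
  exact h

end ComplexClifford

open ComplexClifford

/-- The partial derivative `∂f/∂y_j`. -/
def partialDeriv {m : ℕ} (j : Fin m) (f : EuclideanSpace ℝ (Fin m) → ComplexClifford m)
    (y : EuclideanSpace ℝ (Fin m)) : ComplexClifford m :=
  fderiv ℝ f y (EuclideanSpace.single j 1)

/-- The Gamma operator (angular Dirac operator)
`Γ_y = -∑_{j<k} e_j e_k (y_j ∂_{y_k} - y_k ∂_{y_j})`. -/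
def angularDirac {m : ℕ} (f : EuclideanSpace ℝ (Fin m) → ComplexClifford m) :
    EuclideanSpace ℝ (Fin m) → ComplexClifford m := fun y =>
  -∑ j : Fin m, ∑ k ∈ Finset.Ioi j,
    e j * e k * ((y j : ℂ) • partialDeriv k f y - (y k : ℂ) • partialDeriv j f y)

/-- The homogeneous component of degree `k` of the Taylor expansion of `f` at the origin. -/
def homogeneousPart {m : ℕ} (k : ℕ) (f : EuclideanSpace ℝ (Fin m) → ComplexClifford m) :
    EuclideanSpace ℝ (Fin m) → ComplexClifford m := fun y =>
  ((k.factorial : ℂ)⁻¹) • iteratedDeriv k (fun r : ℝ => f (r • y)) 0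

/-- The `n`-th term of the exponential series `∑_n Tⁿ p / n!`, evaluated at `y`. -/
def expTerm {m : ℕ}
    (T : (EuclideanSpace ℝ (Fin m) → ComplexClifford m) →
      (EuclideanSpace ℝ (Fin m) → ComplexClifford m))
    (p : EuclideanSpace ℝ (Fin m) → ComplexClifford m) (y : EuclideanSpace ℝ (Fin m))
    (n : ℕ) : ComplexClifford m :=
  ((n.factorial : ℂ)⁻¹) • (T^[n] p) y

/-- `exp(T) f`, for an operator `T` that preserves the finite-dimensional spaces of homogeneous
polynomials of each degree: the exponential series is applied to each homogeneous component of the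
Taylor expansion of `f`, and the results are summed. -/
def operatorExp {m : ℕ}
    (T : (EuclideanSpace ℝ (Fin m) → ComplexClifford m) →
      (EuclideanSpace ℝ (Fin m) → ComplexClifford m))
    (f : EuclideanSpace ℝ (Fin m) → ComplexClifford m) :
    EuclideanSpace ℝ (Fin m) → ComplexClifford m := fun y =>
  ∑' k : ℕ, ∑' n : ℕ, expTerm T (homogeneousPart k f) y n

/-- The series defining `exp(T) f` at `y` converge absolutely (degree by degree, and then over
the degrees). -/
def OperatorExpConverges {m : ℕ}
    (T : (EuclideanSpace ℝ (Fin m) → ComplexClifford m) →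
      (EuclideanSpace ℝ (Fin m) → ComplexClifford m))
    (f : EuclideanSpace ℝ (Fin m) → ComplexClifford m) (y : EuclideanSpace ℝ (Fin m)) : Prop :=
  (∀ k : ℕ, Summable fun n : ℕ => ‖expTerm T (homogeneousPart k f) y n‖) ∧
    Summable fun k : ℕ => ‖∑' n : ℕ, expTerm T (homogeneousPart k f) y n‖

/-- The operator `i (π/2) Γ_y²`. -/
def gammaSqExponent {m : ℕ} (f : EuclideanSpace ℝ (Fin m) → ComplexClifford m) :
    EuclideanSpace ℝ (Fin m) → ComplexClifford m := fun y =>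
  (Complex.I * (Real.pi / 2)) • angularDirac (angularDirac f) y

/-- The scalar function `y ↦ e^{-it(x,y)}`, with values in the Clifford algebra. -/
def planeWave {m : ℕ} (x : EuclideanSpace ℝ (Fin m)) (t : ℝ)
    (y : EuclideanSpace ℝ (Fin m)) : ComplexClifford m :=
  algebraMap ℂ (ComplexClifford m) (Complex.exp (-Complex.I * t * (inner ℝ x y : ℝ)))

/-- The function `t ↦ t^{m/2-1} e^{i(π/2)Γ_y²} e^{-it(x,y)}`. -/
def gammaSqKernel {m : ℕ} (x y : EuclideanSpace ℝ (Fin m)) (t : ℝ) : ComplexClifford m :=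
  ((t ^ ((m : ℝ) / 2 - 1) : ℝ) : ℂ) • operatorExp gammaSqExponent (planeWave x t) y

/-- The integrand `e^{-st} F(t)` of the Laplace transform. -/
def laplaceIntegrand {m : ℕ} (F : ℝ → ComplexClifford m) (s : ℂ) (t : ℝ) : ComplexClifford m :=
  Complex.exp (-s * t) • F t

/-- The Laplace transform `∫_0^∞ e^{-st} F(t) dt`. -/
def laplace {m : ℕ} (F : ℝ → ComplexClifford m) (s : ℂ) : ComplexClifford m :=
  ∫ t in Set.Ioi (0 : ℝ), laplaceIntegrand F s t

/-- `√₊ = √(s² + |x|²|y|²)`, the principal square root. -/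
def sqrtPlus {m : ℕ} (x y : EuclideanSpace ℝ (Fin m)) (s : ℂ) : ℂ :=
  (s ^ 2 + (‖x‖ : ℂ) ^ 2 * (‖y‖ : ℂ) ^ 2) ^ ((1 : ℂ) / 2)

/-- The inner product `(x,y)` as a complex number. -/
def innerC {m : ℕ} (x y : EuclideanSpace ℝ (Fin m)) : ℂ := ((inner ℝ x y : ℝ) : ℂ)

/-- `U¹ = (s + √₊ - i yx) / (s + i(x,y))^{m/2}`. -/
def U₁ {m : ℕ} (x y : EuclideanSpace ℝ (Fin m)) (s : ℂ) : ComplexClifford m :=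
  ((s + Complex.I * innerC x y) ^ ((m : ℂ) / 2))⁻¹ •
    (algebraMap ℂ (ComplexClifford m) (s + sqrtPlus x y s) - Complex.I • (vec y * vec x))

/-- `U² = (s + √₊ + i yx) / (s - i(x,y))^{m/2}`. -/
def U₂ {m : ℕ} (x y : EuclideanSpace ℝ (Fin m)) (s : ℂ) : ComplexClifford m :=
  ((s - Complex.I * innerC x y) ^ ((m : ℂ) / 2))⁻¹ •
    (algebraMap ℂ (ComplexClifford m) (s + sqrtPlus x y s) + Complex.I • (vec y * vec x))

/-- `U³ = ((-1)^{m-1} (√₊ - s) + i yx) / (s + (-1)^{m-1} i(x,y))^{m/2}`. -/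
def U₃ {m : ℕ} (x y : EuclideanSpace ℝ (Fin m)) (s : ℂ) : ComplexClifford m :=
  ((s + (-1) ^ (m - 1) * Complex.I * innerC x y) ^ ((m : ℂ) / 2))⁻¹ •
    (algebraMap ℂ (ComplexClifford m) ((-1) ^ (m - 1) * (sqrtPlus x y s - s))
      + Complex.I • (vec y * vec x))

/-- `U⁴ = ((-1)^{m-1} (s - √₊) + i yx) / (s - (-1)^{m-1} i(x,y))^{m/2}`. -/
def U₄ {m : ℕ} (x y : EuclideanSpace ℝ (Fin m)) (s : ℂ) : ComplexClifford m :=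
  ((s - (-1) ^ (m - 1) * Complex.I * innerC x y) ^ ((m : ℂ) / 2))⁻¹ •
    (algebraMap ℂ (ComplexClifford m) ((-1) ^ (m - 1) * (s - sqrtPlus x y s))
      + Complex.I • (vec y * vec x))

end

/-! Write w = (x,y), r = |x||y|, l = m/2. The number e^{iπk²/2} depends only on the parity of the
integer k: it is 1 for even k and i for odd k. So on a sum of eigenfunctions of Γ whose integer
eigenvalues all have one parity, the operator exponential is a scalar
(`expTerm_of_mem_paritySpace`). It suffices to split w^K into a part with eigenvalues of the parity
of K (the functions |y|^{2j} M, M monogenic) and a part with eigenvalues of the parity of K + m (the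
functions |y|^{2j} y M). No individual projection is computed.

The splitting is read off from generating series. The eigenfunctions are C_k + C_{k-1} yx, with
eigenvalue -k, and r² C_{k-2} + C_{k-1} yx, with eigenvalue k + m - 2, where the C_k are homogenized
Gegenbauer polynomials with Σ C_k v^k = (1 - 2wv + r²v²)^{-l}. The substitution u = 2v/(1 + r²v²)
turns (1 - wu)^{-l}, whose coefficients are multiples of w^K, into this series times a radial
factor, and makes (1 - r²u²)^{-1/2} rational in v. Hence the first part of (1 - wu)^{-l} is ½(1 -
wu)^{-l}(1 + (1 - r²u²)^{-1/2} + u(1 - r²u²)^{-1/2} yx), and the second is the remainder. The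
substitution is triangular with radial coefficients that are polynomials in r², so membership in the
span of eigenfunctions passes back from v to u (`mem_paritySpace_of_triangular`).

For the Laplace transform, the degree K term carries t^{l+K-1}/Γ(l+K), up to the constant Γ(l) and
the power of -i. Formally its transform is s^{-l-K}, so u becomes ∓i/s, with (1 - r²u²)^{-1/2} =
s/√₊ and s^{-l}(1 - wu)^{-l} = (s ± iw)^{-l}. To obtain this for every Re s > 0 and not only for
large s, products of series are realised as convolutions of t^{l-1}e^{∓iwt} with the Bessel function
J₀(rt) or its derivative in t (`hasSum_waveConvolution`, `laplace_waveConvolution`). J₀ is treated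
as a circle average of exponentials, and its transform 1/√₊ comes from a mean value property
(`circle_average_inv_sub_cos`).

The phases are combinations of 1 and (-1)^K, which produces the two waves e^{∓itw} and the factors 1
± i (`parityPhase_natCast_add`). The closed formula is then algebra, done separately for odd and
even m. -/

namespace PlaneWaveSpectrum

open PowerSeries

/-! ### Homogenized Gegenbauer polynomials and their recurrences -/

/-- The homogenized Gegenbauer polynomial `N^{k/2} C_k^l(w/√N)` and its derivative in `w`. -/
noncomputable def gegenbauerPair (l w N : ℂ) : ℕ → ℂ × ℂ
  | 0 => (1, 0)
  | k + 1 =>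
    (((k + 2 * l) * w * (gegenbauerPair l w N k).1 - (N - w ^ 2) * (gegenbauerPair l w N k).2)
        / (k + 1),
      w * (gegenbauerPair l w N k).2 + (k + 2 * l) * (gegenbauerPair l w N k).1)

/-- The homogenized Gegenbauer polynomial. -/
noncomputable def gegenbauer (l w N : ℂ) (k : ℕ) : ℂ := (gegenbauerPair l w N k).1

/-- The derivative in `w` of the homogenized Gegenbauer polynomial. -/
noncomputable def gegenbauerDeriv (l w N : ℂ) (k : ℕ) : ℂ := (gegenbauerPair l w N k).2

section Recurrences

variable (l w N : ℂ) (k : ℕ)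

@[simp] theorem gegenbauer_zero : gegenbauer l w N 0 = 1 := rfl

@[simp] theorem gegenbauerDeriv_zero : gegenbauerDeriv l w N 0 = 0 := rfl

theorem succ_mul_gegenbauer_succ :
    ((k : ℂ) + 1) * gegenbauer l w N (k + 1) =
      (k + 2 * l) * w * gegenbauer l w N k - (N - w ^ 2) * gegenbauerDeriv l w N k := by
  have : (k : ℂ) + 1 ≠ 0 := Nat.cast_add_one_ne_zero k
  simp only [gegenbauer, gegenbauerDeriv, gegenbauerPair]
  field_simp

theorem gegenbauerDeriv_succ :
    gegenbauerDeriv l w N (k + 1) =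
      w * gegenbauerDeriv l w N k + (k + 2 * l) * gegenbauer l w N k := rfl

theorem gegenbauer_one : gegenbauer l w N 1 = 2 * l * w := by
  have := succ_mul_gegenbauer_succ l w N 0
  simpa using this

/-- Together with `gegenbauerDeriv_succ`, this is the pair of relations that the two components of
the eigenvalue equation for Γ reduce to. The joint recursion is set up so that both hold without
knowing that the second entry is a derivative. -/
theorem mul_gegenbauerDeriv_succ_sub :
    w * gegenbauerDeriv l w N (k + 1) - N * gegenbauerDeriv l w N k =
      (k + 1) * gegenbauer l w N (k + 1) := by
  rw [succ_mul_gegenbauer_succ, gegenbauerDeriv_succ]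
  ring

theorem gegenbauer_three_term :
    ((k : ℂ) + 2) * gegenbauer l w N (k + 2) =
      2 * (k + 1 + l) * w * gegenbauer l w N (k + 1) - (k + 2 * l) * N * gegenbauer l w N k := by
  have h := succ_mul_gegenbauer_succ l w N (k + 1)
  have h' := succ_mul_gegenbauer_succ l w N k
  rw [gegenbauerDeriv_succ] at h
  push_cast at h
  linear_combination h - w * h'

theorem gegenbauerDeriv_three_term :
    ((k : ℂ) + 2) * gegenbauerDeriv l w N (k + 2) =
      2 * (k + 1 + l) * (gegenbauer l w N (k + 1) + w * gegenbauerDeriv l w N (k + 1))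
        - (k + 2 * l) * N * gegenbauerDeriv l w N k := by
  have h := gegenbauerDeriv_succ l w N (k + 1)
  have h' := mul_gegenbauerDeriv_succ_sub l w N k
  push_cast at h
  linear_combination (k + 2 : ℂ) * h - (k + 2 * l) * h'

end Recurrences

/-! ### Binomial-type power series characterised by linear differential equations -/

/-- The coefficients of `(1 - u)^{-l}`. -/
noncomputable def risingCoeff (l : ℂ) : ℕ → ℂ
  | 0 => 1
  | n + 1 => (l + n) / (n + 1) * risingCoeff l n

/-- The coefficients of `(1 - u²)^{-μ}`. -/
noncomputable def evenCoeff (μ : ℂ) : ℕ → ℂ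
  | 0 => 1
  | 1 => 0
  | n + 2 => (n + 2 * μ) / (n + 2) * evenCoeff μ n

theorem evenCoeff_of_odd (μ : ℂ) {n : ℕ} (hn : Odd n) : evenCoeff μ n = 0 := by
  obtain ⟨k, rfl⟩ := hn
  induction k with
  | zero => rfl
  | succ k ih =>
    rw [show 2 * (k + 1) + 1 = (2 * k + 1) + 2 by ring, evenCoeff, ih, mul_zero]

/-- The power series `(1 - w u)^{-l}`. -/
noncomputable def risingSeries (l w : ℂ) : ℂ⟦X⟧ := mk fun n => risingCoeff l n * w ^ n

/-- The power series `(1 - r² u²)^{-μ}`. -/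
noncomputable def evenSeries (μ r : ℂ) : ℂ⟦X⟧ := mk fun n => evenCoeff μ n * r ^ n

/-- The generating series of the homogenized Gegenbauer polynomials. -/
noncomputable def gegenbauerSeries (l w N : ℂ) : ℂ⟦X⟧ := mk fun n => gegenbauer l w N n

theorem risingSeries_ode (l w : ℂ) :
    (1 - C w * X) * d⁄dX ℂ (risingSeries l w) = C (l * w) * risingSeries l w := by
  ext n
  rw [sub_mul, one_mul, map_sub, mul_assoc, coeff_C_mul, coeff_C_mul]
  rcases n with _ | n
  · simp [coeff_derivative, risingSeries, risingCoeff]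
  · have h1 : (n : ℂ) + 1 + 1 ≠ 0 := by norm_cast
    rw [mul_comm X, coeff_succ_mul_X]
    simp only [coeff_derivative, risingSeries, coeff_mk, risingCoeff]
    push_cast
    field_simp
    ring

theorem evenSeries_ode (μ r : ℂ) :
    (1 - C (r ^ 2) * X ^ 2) * d⁄dX ℂ (evenSeries μ r) =
      C (2 * μ * r ^ 2) * X * evenSeries μ r := by
  ext n
  rw [sub_mul, one_mul, map_sub, mul_assoc, coeff_C_mul, mul_assoc, coeff_C_mul]
  rcases n with _ | _ | n
  · simp [coeff_derivative, evenSeries, evenCoeff]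
  · rw [mul_comm X, coeff_succ_mul_X, coeff_X_pow_mul']
    simp [coeff_derivative, evenSeries, evenCoeff]
    ring
  · have h1 : (n : ℂ) + 1 + 1 + 1 ≠ 0 := by norm_cast
    have h2 : (n : ℂ) + 1 + 2 ≠ 0 := by
      rw [add_assoc] at h1 ⊢; convert h1 using 1; ring
    rw [mul_comm X, coeff_succ_mul_X, show n + 1 + 1 = n + 2 from rfl, coeff_X_pow_mul]
    simp only [coeff_derivative, evenSeries, coeff_mk, show n + 2 + 1 = (n + 1) + 2 from rfl,
      evenCoeff]
    push_cast
    field_simp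
    ring

theorem gegenbauerSeries_ode (l w N : ℂ) :
    (1 - C (2 * w) * X + C N * X ^ 2) * d⁄dX ℂ (gegenbauerSeries l w N) =
      C (2 * l) * (C w - C N * X) * gegenbauerSeries l w N := by
  have key : d⁄dX ℂ (gegenbauerSeries l w N) - C (2 * w) * (d⁄dX ℂ (gegenbauerSeries l w N) * X)
      + C N * (X ^ 2 * d⁄dX ℂ (gegenbauerSeries l w N)) =
      C (2 * l * w) * gegenbauerSeries l w N
        - C (2 * l * N) * (gegenbauerSeries l w N * X) := by
    ext n
    simp only [map_add, map_sub, coeff_C_mul]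
    rcases n with _ | _ | n
    · simp [coeff_derivative, gegenbauerSeries, gegenbauer_one]
    · have h := gegenbauer_three_term l w N 0
      rw [show (0 + 1 : ℕ) = 0 + 1 from rfl, coeff_succ_mul_X, coeff_succ_mul_X, coeff_X_pow_mul']
      simp only [coeff_derivative, gegenbauerSeries, coeff_mk]
      norm_num at h ⊢
      rw [gegenbauer_one] at h ⊢
      linear_combination h
    · have h := gegenbauer_three_term l w N (n + 1)
      rw [show n + 1 + 1 = (n + 1) + 1 from rfl, coeff_succ_mul_X, coeff_succ_mul_X,
        show n + 1 + 1 = n + 2 from rfl, coeff_X_pow_mul]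
      simp only [coeff_derivative, gegenbauerSeries, coeff_mk]
      rw [show n + 1 + 2 = n + 2 + 1 from rfl, show n + 1 + 1 = n + 2 from rfl] at h
      push_cast at h ⊢
      linear_combination h
  simp only [map_mul] at key ⊢
  linear_combination key

/-- Uniqueness for linear first-order differential equations of power series. -/
theorem eq_of_linear_ode {P Q f g : ℂ⟦X⟧} (hP : constantCoeff P = 1)
    (hf : P * d⁄dX ℂ f = Q * f) (hg : P * d⁄dX ℂ g = Q * g)
    (hf0 : constantCoeff f = 1) (hg0 : constantCoeff g = 1) : f = g := by
  have hP0 : P ≠ 0 := by rintro rfl; simp at hP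
  have hgg : g * g⁻¹ = 1 := PowerSeries.mul_inv_cancel g (by rw [hg0]; exact one_ne_zero)
  have hw : d⁄dX ℂ f * g = f * d⁄dX ℂ g := by
    apply mul_left_cancel₀ hP0
    linear_combination g * hf - f * hg
  have h1 : f * g⁻¹ = 1 := by
    apply derivative.ext
    · rw [Derivation.leibniz, derivative_inv', Derivation.map_one_eq_zero, smul_eq_mul, smul_eq_mul]
      linear_combination (g⁻¹) ^ 2 * hw - (g⁻¹ * d⁄dX ℂ f) * hgg
    · simp [hf0, hg0]
  calc f = f * g⁻¹ * g := by linear_combination -f * hgg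
    _ = g := by rw [h1, one_mul]

theorem one_sub_mul_evenSeries_one (r : ℂ) :
    (1 - C (r ^ 2) * X ^ 2) * evenSeries 1 r = 1 := by
  ext n
  rw [sub_mul, one_mul, map_sub, mul_assoc, coeff_C_mul]
  rcases n with _ | _ | n
  · simp [evenSeries, evenCoeff]
  · rw [coeff_X_pow_mul']
    simp [evenSeries, evenCoeff, coeff_one]
  · have h1 : (n : ℂ) + 2 ≠ 0 := by norm_cast
    rw [show n + 1 + 1 = n + 2 from rfl, coeff_X_pow_mul, coeff_one, if_neg (by omega)]
    simp only [evenSeries, coeff_mk, evenCoeff, mul_one]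
    field_simp
    ring

/-! ### The substitution u = 2v/(1 + r²v²) -/

/-- The substitution `u = 2v / (1 + r² v²)`. -/
noncomputable def uniformizer (r : ℂ) : ℂ⟦X⟧ := C 2 * X * evenSeries 1 (Complex.I * r)

theorem one_add_mul_evenSeries (r : ℂ) :
    (1 + C (r ^ 2) * X ^ 2) * evenSeries 1 (Complex.I * r) = 1 := by
  have := one_sub_mul_evenSeries_one (Complex.I * r)
  rw [mul_pow, Complex.I_sq, neg_one_mul, map_neg] at this
  linear_combination this

theorem one_add_mul_uniformizer (r : ℂ) :
    (1 + C (r ^ 2) * X ^ 2) * uniformizer r = C 2 * X := by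
  rw [uniformizer]
  linear_combination (C 2 * X) * one_add_mul_evenSeries r

theorem hasSubst_uniformizer (r : ℂ) : HasSubst (uniformizer r) :=
  HasSubst.of_constantCoeff_zero' (by simp [uniformizer])

theorem derivative_uniformizer (r : ℂ) :
    (1 + C (r ^ 2) * X ^ 2) ^ 2 * d⁄dX ℂ (uniformizer r) = C 2 * (1 - C (r ^ 2) * X ^ 2) := by
  have h := congrArg (d⁄dX ℂ) (one_add_mul_uniformizer r)
  have h0 := one_add_mul_uniformizer r
  generalize r ^ 2 = c at *
  simp only [Derivation.leibniz, map_add, Derivation.map_one_eq_zero, derivative_C, derivative_X,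
    derivative_pow, smul_eq_mul, zero_add, mul_zero, add_zero, mul_one] at h
  norm_num at h
  have h2 : (C (2 : ℂ) : ℂ⟦X⟧) = 2 := map_ofNat _ 2
  rw [h2] at h h0 ⊢
  linear_combination (1 + C c * X ^ 2) * h - (2 * C c * X) * h0

theorem constantCoeff_subst_uniformizer (r : ℂ) (f : ℂ⟦X⟧) :
    constantCoeff (f.subst (uniformizer r)) = constantCoeff f := by
  have hU : constantCoeff (uniformizer r) = 0 := by simp [uniformizer]
  have h := PowerSeries.constantCoeff_subst_eq_zero (a := uniformizer r) hU
    (f - C (constantCoeff f)) (by simp)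
  rw [subst_sub (hasSubst_uniformizer r)] at h
  have h2 : (C (constantCoeff f) : ℂ⟦X⟧).subst (uniformizer r) = C (constantCoeff f) :=
    subst_C _
  rw [h2] at h
  change constantCoeff (subst (uniformizer r) f - C (constantCoeff f)) = 0 at h
  rw [map_sub, sub_eq_zero] at h
  rw [h]; simp

theorem subst_C_uniformizer (r c : ℂ) : (C c : ℂ⟦X⟧).subst (uniformizer r) = C c := subst_C c

theorem subst_one_uniformizer (r : ℂ) : (1 : ℂ⟦X⟧).subst (uniformizer r) = 1 := by
  have := subst_C_uniformizer r 1
  simpa using this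

theorem subst_X_uniformizer (r : ℂ) : (X : ℂ⟦X⟧).subst (uniformizer r) = uniformizer r :=
  subst_X (hasSubst_uniformizer r)

/-- Since 1 - wu = (1 - 2wv + r²v²)/(1 + r²v²), its power -l is the Gegenbauer generating function
times (1 + r²v²)^l. Complex powers of series are avoided: both sides solve the same first-order
linear equation in v with constant term 1. -/
theorem risingSeries_subst (l w r : ℂ) :
    (risingSeries l w).subst (uniformizer r) =
      evenSeries (-l) (Complex.I * r) * gegenbauerSeries l w (r ^ 2) := by
  have hU := hasSubst_uniformizer r
  have h2 : (C (2 : ℂ) : ℂ⟦X⟧) = 2 := map_ofNat _ 2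
  set T : ℂ⟦X⟧ := 1 + C (r ^ 2) * X ^ 2 with hT
  apply eq_of_linear_ode (P := T * (T - C (2 * w) * X))
    (Q := C (2 * l * w) * (1 - C (r ^ 2) * X ^ 2))
  · simp [hT]
  · have h := congrArg (fun f : ℂ⟦X⟧ => f.subst (uniformizer r)) (risingSeries_ode l w)
    simp only [subst_mul hU, subst_sub hU, subst_one_uniformizer, subst_C_uniformizer,
      subst_X_uniformizer] at h
    rw [derivative_subst hU]
    have h1 := one_add_mul_uniformizer r
    have h3 := derivative_uniformizer r
    rw [← hT] at h1 h3
    simp only [map_mul, h2] at *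
    linear_combination T ^ 2 * d⁄dX ℂ (uniformizer r) * h
      + (C l * C w * subst (uniformizer r) (risingSeries l w)) * h3
      + T * C w * subst (uniformizer r) (d⁄dX ℂ (risingSeries l w)) *
        d⁄dX ℂ (uniformizer r) * h1
  · have h := evenSeries_ode (-l) (Complex.I * r)
    have h' := gegenbauerSeries_ode l w (r ^ 2)
    rw [Derivation.leibniz, smul_eq_mul, smul_eq_mul]
    rw [mul_pow, Complex.I_sq] at h
    simp only [map_mul, map_neg, map_one, h2, hT] at *
    linear_combination ((1 + C (r ^ 2) * X ^ 2) - 2 * C w * X) * gegenbauerSeries l w (r ^ 2) * h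
      + (1 + C (r ^ 2) * X ^ 2) * evenSeries (-l) (Complex.I * r) * h'
  · rw [constantCoeff_subst_uniformizer]
    simp [risingSeries, risingCoeff]
  · simp [evenSeries, evenCoeff, gegenbauerSeries]

/-- The substitution makes 1 - r²u² the square of (1 - r²v²)/(1 + r²v²), so its inverse square root
becomes rational. -/
theorem evenSeries_subst (r : ℂ) :
    (evenSeries (1 / 2) r).subst (uniformizer r) =
      (1 + C (r ^ 2) * X ^ 2) * evenSeries 1 r := by
  have hU := hasSubst_uniformizer r
  have h2 : (C (2 : ℂ) : ℂ⟦X⟧) = 2 := map_ofNat _ 2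
  set T : ℂ⟦X⟧ := 1 + C (r ^ 2) * X ^ 2 with hT
  set S : ℂ⟦X⟧ := 1 - C (r ^ 2) * X ^ 2 with hS
  have hS0 : S ≠ 0 := by
    intro h
    have := congrArg constantCoeff h
    simp [hS] at this
  apply eq_of_linear_ode (P := T * S) (Q := 4 * C (r ^ 2) * X)
  · simp [hT, hS]
  · have h := congrArg (fun f : ℂ⟦X⟧ => f.subst (uniformizer r)) (evenSeries_ode (1 / 2) r)
    simp only [subst_mul hU, subst_sub hU, subst_pow hU, subst_one_uniformizer,
      subst_C_uniformizer, subst_X_uniformizer] at h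
    rw [derivative_subst hU]
    have h1 := one_add_mul_uniformizer r
    have h3 := derivative_uniformizer r
    rw [← hT] at h1 h3
    rw [← hS] at h3
    rw [show (2 : ℂ) * (1 / 2) * r ^ 2 = r ^ 2 by ring] at h
    apply mul_left_cancel₀ hS0
    have h4 : T ^ 2 * (1 - C (r ^ 2) * uniformizer r ^ 2) = S ^ 2 := by
      have : T ^ 2 * (C (r ^ 2) * uniformizer r ^ 2) = C (r ^ 2) * (T * uniformizer r) ^ 2 := by
        ring
      rw [mul_sub, this, h1, hS, hT, h2]
      ring
    simp only [h2] at *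
    linear_combination T ^ 3 * d⁄dX ℂ (uniformizer r) * h
      - T * subst (uniformizer r) (d⁄dX ℂ (evenSeries (1 / 2) r)) * d⁄dX ℂ (uniformizer r) * h4
      + C (r ^ 2) * subst (uniformizer r) (evenSeries (1 / 2) r) * T ^ 2 *
        d⁄dX ℂ (uniformizer r) * h1
      + 2 * X * C (r ^ 2) * subst (uniformizer r) (evenSeries (1 / 2) r) * h3
  · have h := evenSeries_ode 1 r
    rw [Derivation.leibniz, smul_eq_mul, smul_eq_mul]
    simp only [map_add, Derivation.leibniz, Derivation.map_one_eq_zero, derivative_C, derivative_X,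
      derivative_pow, smul_eq_mul, hT]
    rw [← hS] at h
    simp only [map_mul, h2, map_one] at *
    push_cast
    linear_combination (1 + C (r ^ 2) * X ^ 2) ^ 2 * h
  · rw [constantCoeff_subst_uniformizer]
    simp [evenSeries, evenCoeff]
  · simp [hT, evenSeries, evenCoeff]

end PlaneWaveSpectrum

/-! ### Generating series of the two components of the powers of (x,y) -/

namespace PlaneWaveSpectrum

open PowerSeries

theorem evenSeries_mul_eq_rescale (μ c r : ℂ) :
    evenSeries μ (c * r) = rescale r (evenSeries μ c) := by
  ext n
  simp only [evenSeries, coeff_mk, coeff_rescale, mul_pow]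
  ring

theorem rescale_neg_one_evenSeries (μ c : ℂ) :
    rescale (-1) (evenSeries μ c) = evenSeries μ c := by
  ext n
  rw [coeff_rescale, evenSeries, coeff_mk]
  rcases Nat.even_or_odd n with h | h
  · rw [h.neg_one_pow, one_mul]
  · rw [evenCoeff_of_odd μ h]; ring

theorem coeff_eq_zero_of_rescale_neg_one {f : ℂ⟦X⟧} (hf : rescale (-1) f = f) {n : ℕ}
    (hn : Odd n) : coeff n f = 0 := by
  have h := congrArg (coeff n) hf
  rw [coeff_rescale, hn.neg_one_pow] at h
  linear_combination (-1 / 2 : ℂ) * h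

/-- The coefficient of `v^n` in the `K`-th power of `2v / (1 + v²)`. -/
noncomputable def uniformizerCoeff (n K : ℕ) : ℂ :=
  2 ^ K * coeff (n - K) (evenSeries 1 Complex.I ^ K)

theorem uniformizerCoeff_self (n : ℕ) : uniformizerCoeff n n ≠ 0 := by
  simp [uniformizerCoeff, evenSeries, evenCoeff]

/-- Only even powers of r occur in the change of variable. This keeps the coefficients smooth in y
at the origin and preserves parities. -/
theorem uniformizerCoeff_of_odd {n K : ℕ} (h : Odd (n - K)) : uniformizerCoeff n K = 0 := by
  rw [uniformizerCoeff, coeff_eq_zero_of_rescale_neg_one _ h, mul_zero]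
  rw [map_pow, rescale_neg_one_evenSeries]

theorem coeff_uniformizer_pow (r : ℂ) (n K : ℕ) :
    coeff n (uniformizer r ^ K) = if K ≤ n then uniformizerCoeff n K * r ^ (n - K) else 0 := by
  have h : uniformizer r ^ K =
      C (2 ^ K) * (X ^ K * rescale r (evenSeries 1 Complex.I ^ K)) := by
    rw [uniformizer, evenSeries_mul_eq_rescale, map_pow, map_pow, mul_pow, mul_pow, mul_assoc]
  rw [h, coeff_C_mul, coeff_X_pow_mul']
  split_ifs
  · rw [coeff_rescale, uniformizerCoeff]; ring
  · rw [mul_zero]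

theorem coeff_subst_uniformizer (r : ℂ) (f : ℂ⟦X⟧) (n : ℕ) :
    coeff n (f.subst (uniformizer r)) =
      ∑ K ∈ Finset.range (n + 1), uniformizerCoeff n K * r ^ (n - K) * coeff K f := by
  rw [coeff_subst' (hasSubst_uniformizer r), finsum_eq_sum_of_support_subset (s := Finset.range (n + 1))]
  · refine Finset.sum_congr rfl fun K hK => ?_
    rw [coeff_uniformizer_pow, if_pos (by simpa [Nat.lt_succ_iff] using hK), smul_eq_mul, mul_comm]
  · intro K hK
    by_contra h
    apply hK
    have : ¬ K ≤ n := by simpa [Nat.lt_succ_iff] using h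
    simp only [coeff_uniformizer_pow, if_neg this, smul_zero]

/-- The scalar part of the generating series of the projections of `(x,y)^K`. -/
noncomputable def scalarPartSeries (l w r : ℂ) : ℂ⟦X⟧ :=
  C (1 / 2) * risingSeries l w * (1 + evenSeries (1 / 2) r)

/-- The coefficient of `yx` in the generating series of the projections of `(x,y)^K`. -/
noncomputable def bivectorPartSeries (l w r : ℂ) : ℂ⟦X⟧ :=
  C (1 / 2) * X * risingSeries l w * evenSeries (1 / 2) r

/-- The radial factor relating the projections of `(x,y)^K` to zonal eigenfunctions. -/
noncomputable def radialSeries (l r : ℂ) : ℂ⟦X⟧ := evenSeries (-l) (Complex.I * r) * evenSeries 1 r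

/-- The point is ½(1 + (1 + r²v²)/(1 - r²v²)) = 1/(1 - r²v²). -/
theorem scalarPartSeries_subst (l w r : ℂ) :
    (scalarPartSeries l w r).subst (uniformizer r) =
      radialSeries l r * gegenbauerSeries l w (r ^ 2) := by
  have hU := hasSubst_uniformizer r
  have h2 : (C (1 / 2 : ℂ) : ℂ⟦X⟧) * 2 = 1 := by
    rw [← map_ofNat C, ← map_mul]; norm_num
  rw [scalarPartSeries, subst_mul hU, subst_mul hU, subst_add hU, subst_C_uniformizer,
    subst_one_uniformizer, risingSeries_subst, evenSeries_subst, radialSeries]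
  have h := one_sub_mul_evenSeries_one r
  linear_combination (evenSeries (-l) (Complex.I * r) * gegenbauerSeries l w (r ^ 2) *
    evenSeries 1 r) * h2 - (C (1 / 2) * evenSeries (-l) (Complex.I * r) *
      gegenbauerSeries l w (r ^ 2)) * h

theorem bivectorPartSeries_subst (l w r : ℂ) :
    (bivectorPartSeries l w r).subst (uniformizer r) =
      radialSeries l r * (X * gegenbauerSeries l w (r ^ 2)) := by
  have hU := hasSubst_uniformizer r
  have h2 : (C (1 / 2 : ℂ) : ℂ⟦X⟧) * C 2 = 1 := by
    rw [← map_mul]; norm_num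
  rw [bivectorPartSeries, subst_mul hU, subst_mul hU, subst_mul hU, subst_C_uniformizer,
    subst_X_uniformizer, risingSeries_subst, evenSeries_subst, radialSeries]
  have h := one_add_mul_uniformizer r
  linear_combination (evenSeries (-l) (Complex.I * r) * gegenbauerSeries l w (r ^ 2) *
    evenSeries 1 r * C (1 / 2)) * h +
    (X * evenSeries (-l) (Complex.I * r) * gegenbauerSeries l w (r ^ 2) * evenSeries 1 r) * h2

/-- Here 1 - 1/(1 - r²v²) = -r²v²/(1 - r²v²). With the sign of the bivector part also reversed, this
is minus the generating series of r² C_{k-2} + C_{k-1} yx, times the same radial factor. -/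
theorem risingSeries_sub_scalarPartSeries_subst (l w r : ℂ) :
    (risingSeries l w - scalarPartSeries l w r).subst (uniformizer r) =
      -(radialSeries l r * (C (r ^ 2) * X ^ 2 * gegenbauerSeries l w (r ^ 2))) := by
  rw [subst_sub (hasSubst_uniformizer r), scalarPartSeries_subst, risingSeries_subst, radialSeries]
  have h := one_sub_mul_evenSeries_one r
  linear_combination -(evenSeries (-l) (Complex.I * r) * gegenbauerSeries l w (r ^ 2)) * h

theorem radialSeries_eq_rescale (l r : ℂ) : radialSeries l r = rescale r (radialSeries l 1) := by
  rw [radialSeries, radialSeries, map_mul, evenSeries_mul_eq_rescale]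
  congr 1
  · rw [mul_one]
  · rw [← evenSeries_mul_eq_rescale, one_mul]

theorem coeff_radialSeries (l r : ℂ) (n : ℕ) :
    coeff n (radialSeries l r) = r ^ n * coeff n (radialSeries l 1) := by
  rw [radialSeries_eq_rescale, coeff_rescale]

theorem coeff_radialSeries_of_odd (l : ℂ) {n : ℕ} (hn : Odd n) :
    coeff n (radialSeries l 1) = 0 := by
  apply coeff_eq_zero_of_rescale_neg_one _ hn
  rw [radialSeries, map_mul, rescale_neg_one_evenSeries, rescale_neg_one_evenSeries]

end PlaneWaveSpectrum

namespace PlaneWaveSpectrum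

open ComplexClifford
open scoped ContDiff

variable {m : ℕ}

/-! ### Clifford algebra identities -/

section Algebra

/-- The embedding of vectors as a linear map. -/
noncomputable def vecLinear (m : ℕ) : EuclideanSpace ℝ (Fin m) →ₗ[ℝ] ComplexClifford m where
  toFun := vec
  map_add' x y := by
    simp only [vec, map_add, TensorProduct.tmul_add]
    rfl
  map_smul' c x := by
    simp only [vec, map_smul, TensorProduct.tmul_smul, RingHom.id_apply]
    change c • ((1 : ℂ) ⊗ₜ[ℝ] CliffordAlgebra.ι (cliffordForm m) x) = (c : ℂ) • _
    erw [TensorProduct.smul_tmul']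

theorem vecLinear_apply (x : EuclideanSpace ℝ (Fin m)) : vecLinear m x = vec x := rfl

theorem vec_add (x y : EuclideanSpace ℝ (Fin m)) : vec (x + y) = vec x + vec y :=
  map_add (vecLinear m) x y

theorem vec_smul (c : ℝ) (x : EuclideanSpace ℝ (Fin m)) : vec (c • x) = (c : ℂ) • vec x :=
  map_smul (vecLinear m) c x

theorem vec_mul_add_vec_mul (x y : EuclideanSpace ℝ (Fin m)) :
    vec x * vec y + vec y * vec x = (-2 * innerC x y) • (1 : ComplexClifford m) := by
  have h := vec_mul_self (x + y)
  rw [vec_add, add_mul, mul_add, mul_add, vec_mul_self, vec_mul_self] at h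
  simp only [Algebra.algebraMap_eq_smul_one] at h
  have h1 : ((‖x + y‖ : ℝ) : ℂ) ^ 2 = (‖x‖ : ℂ) ^ 2 + 2 * innerC x y + (‖y‖ : ℂ) ^ 2 := by
    rw [innerC]; exact_mod_cast norm_add_sq_real x y
  rw [h1] at h
  have h2 : vec x * vec y + vec y * vec x =
      (-(‖x‖ ^ 2 + 2 * innerC x y + ‖y‖ ^ 2) : ℂ) • (1 : ComplexClifford m) -
      (-(‖x‖ : ℂ) ^ 2) • (1 : ComplexClifford m) - (-(‖y‖ : ℂ) ^ 2) • (1 : ComplexClifford m) := by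
    rw [← h]; abel
  rw [h2, ← sub_smul, ← sub_smul]
  congr 1; ring

theorem e_mul_self (j : Fin m) : e j * e j = (-1 : ComplexClifford m) := by
  rw [e, vec_mul_self]; simp

theorem e_mul_e_of_ne {j k : Fin m} (h : j ≠ k) : (e k * e j : ComplexClifford m) = -(e j * e k) := by
  have := vec_mul_add_vec_mul (EuclideanSpace.single j (1 : ℝ)) (EuclideanSpace.single k (1 : ℝ))
  have h0 : innerC (EuclideanSpace.single j (1 : ℝ)) (EuclideanSpace.single k (1 : ℝ)) = 0 := by
    simp [innerC, EuclideanSpace.inner_single_left, h]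
  rw [h0, mul_zero, zero_smul] at this
  exact eq_neg_of_add_eq_zero_right this

theorem vec_eq_sum (y : EuclideanSpace ℝ (Fin m)) : vec y = ∑ j, (y j : ℂ) • e j := by
  have h : y = ∑ j, y j • EuclideanSpace.single j (1 : ℝ) := by
    ext i
    simp [Finset.sum_apply, Pi.single_apply]
  conv_lhs => rw [h, ← vecLinear_apply, map_sum]
  simp only [vecLinear_apply, vec_smul, e]

theorem innerC_eq_sum (x y : EuclideanSpace ℝ (Fin m)) : innerC x y = ∑ j, (y j : ℂ) * x j := by
  simp [innerC, PiLp.inner_apply]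

theorem sum_sum_eq_diag_add {A : Type*} [AddCommMonoid A] (f : Fin m → Fin m → A) :
    ∑ j, ∑ k, f j k = ∑ j, f j j + ∑ j, ∑ k ∈ Finset.Ioi j, (f j k + f k j) := by
  have h1 : ∀ j, ∑ k, f j k = f j j + (∑ k ∈ Finset.Ioi j, f j k + ∑ k ∈ Finset.Iio j, f j k) := by
    intro j
    rw [← Finset.sum_union, ← Finset.sum_insert (f := f j) (a := j)]
    · congr 1
      ext k
      rcases lt_trichotomy j k with h | h | h <;> simp [h]
    · simp
    · exact Finset.disjoint_left.mpr fun a ha hb =>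
        lt_asymm (Finset.mem_Ioi.mp ha) (Finset.mem_Iio.mp hb)
  have h2 : ∑ j, ∑ k ∈ Finset.Iio j, f j k = ∑ j, ∑ k ∈ Finset.Ioi j, f k j := by
    rw [Finset.sum_comm' (t' := Finset.univ) (s' := fun k => Finset.Ioi k)]
    simp
  simp only [h1, Finset.sum_add_distrib, h2]

/-- This is yx = -(x,y) + y ∧ x: the diagonal terms of the double sum for yx give the scalar part,
the off-diagonal ones pair up by anticommutation. -/
theorem sum_e_mul_e_smul (x y : EuclideanSpace ℝ (Fin m)) :
    ∑ j, ∑ k ∈ Finset.Ioi j, ((y j : ℂ) * x k - y k * x j) • (e j * e k : ComplexClifford m) =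
      vec y * vec x + innerC x y • 1 := by
  have h := sum_sum_eq_diag_add (m := m)
    fun j k => ((y j : ℂ) * x k) • (e j * e k : ComplexClifford m)
  have h1 : ∑ j, ∑ k, ((y j : ℂ) * x k) • (e j * e k : ComplexClifford m) = vec y * vec x := by
    simp only [vec_eq_sum y, vec_eq_sum x, Finset.sum_mul_sum, smul_mul_smul_comm]
  have h2 : ∑ j, ((y j : ℂ) * x j) • (e j * e j : ComplexClifford m) = -(innerC x y • 1) := by
    simp only [e_mul_self, innerC_eq_sum, Finset.sum_smul, smul_neg, Finset.sum_neg_distrib]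
  rw [h1, h2] at h
  rw [h, add_comm _ (innerC x y • (1 : ComplexClifford m)), ← add_assoc, add_neg_cancel, zero_add]
  refine Finset.sum_congr rfl fun j _ => Finset.sum_congr rfl fun k hk => ?_
  rw [e_mul_e_of_ne (Finset.mem_Ioi.mp hk).ne, smul_neg, sub_smul, ← sub_eq_add_neg]

/-- Up to sign this says Γ_y y = (m - 1) y: each index lies in m - 1 pairs, and e_j e_k sends e_k to
-e_j and e_j to e_k. -/
theorem sum_e_mul_e_mul (y : EuclideanSpace ℝ (Fin m)) :
    ∑ j, ∑ k ∈ Finset.Ioi j, (e j * e k * ((y j : ℂ) • e k - (y k : ℂ) • e j) : ComplexClifford m) =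
      -(((m : ℂ) - 1) • vec y) := by
  have h := sum_sum_eq_diag_add (m := m) fun j _ => (y j : ℂ) • (e j : ComplexClifford m)
  simp only [← vec_eq_sum, Finset.sum_const, Finset.card_univ, Fintype.card_fin] at h
  rw [← Finset.smul_sum, ← vec_eq_sum] at h
  have h1 : ∑ j, ∑ k ∈ Finset.Ioi j,
      (e j * e k * ((y j : ℂ) • e k - (y k : ℂ) • e j) : ComplexClifford m) =
      -∑ j, ∑ k ∈ Finset.Ioi j, ((y j : ℂ) • (e j : ComplexClifford m) + (y k : ℂ) • e k) := by
    rw [← Finset.sum_neg_distrib]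
    refine Finset.sum_congr rfl fun j _ => ?_
    rw [← Finset.sum_neg_distrib]
    refine Finset.sum_congr rfl fun k hk => ?_
    have h2 : (e j * e k * e k : ComplexClifford m) = -e j := by
      rw [mul_assoc, e_mul_self, mul_neg, mul_one]
    have h3 : (e j * e k * e j : ComplexClifford m) = e k := by
      rw [mul_assoc, e_mul_e_of_ne (Finset.mem_Ioi.mp hk).ne, mul_neg, ← mul_assoc, e_mul_self,
        neg_mul, neg_neg, one_mul]
    rw [mul_sub, mul_smul_comm, mul_smul_comm, h2, h3, smul_neg, neg_add, sub_eq_add_neg]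
  rw [h1, sub_smul, one_smul, Nat.cast_smul_eq_nsmul, h, add_sub_cancel_left]

/-- The quadratic relation `(yx)² = -2(x,y) yx - |x|²|y|²`. -/
theorem vec_mul_vec_sq (x y : EuclideanSpace ℝ (Fin m)) :
    (vec y * vec x) * (vec y * vec x) =
      (-2 * innerC x y) • (vec y * vec x) - ((‖x‖ : ℂ) * ‖y‖) ^ 2 • (1 : ComplexClifford m) := by
  have h : vec x * vec y = (-2 * innerC x y) • (1 : ComplexClifford m) - vec y * vec x :=
    eq_sub_of_add_eq (vec_mul_add_vec_mul x y)
  calc (vec y * vec x) * (vec y * vec x) = vec y * (vec x * vec y) * vec x := by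
        simp only [mul_assoc]
    _ = (-2 * innerC x y) • (vec y * vec x) - (vec y * vec y) * (vec x * vec x) := by
        rw [h]
        simp only [mul_sub, sub_mul, mul_smul_comm, smul_mul_assoc, mul_one, mul_assoc]
    _ = _ := by
        rw [vec_mul_self, vec_mul_self, ← map_mul, Algebra.algebraMap_eq_smul_one]
        congr 2; ring

end Algebra

/-! ### The Gamma operator, its exponential, and spaces of eigenfunctions of one parity -/

section Operator

/-- Left multiplication as a continuous linear map. -/
noncomputable def mulLeftCLM (a : ComplexClifford m) : ComplexClifford m →L[ℂ] ComplexClifford m :=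
  (LinearMap.mulLeft ℂ a).toContinuousLinearMap

variable {f g : EuclideanSpace ℝ (Fin m) → ComplexClifford m}

theorem contDiff_partialDeriv (j : Fin m) (hf : ContDiff ℝ ∞ f) :
    ContDiff ℝ ∞ (partialDeriv j f) :=
  (hf.fderiv_right (m := ∞) (by simp)).clm_apply contDiff_const

theorem contDiff_coord (j : Fin m) :
    ContDiff ℝ ∞ fun y : EuclideanSpace ℝ (Fin m) => (y j : ℂ) :=
  Complex.ofRealCLM.contDiff.comp (EuclideanSpace.proj (𝕜 := ℝ) j).contDiff

theorem contDiff_angularDirac (hf : ContDiff ℝ ∞ f) : ContDiff ℝ ∞ (angularDirac f) := by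
  refine ContDiff.neg (ContDiff.sum fun j _ => ContDiff.sum fun k _ => ?_)
  refine ((mulLeftCLM (e j * e k)).restrictScalars ℝ).contDiff.comp (ContDiff.sub ?_ ?_)
  · exact (contDiff_coord j).smul (contDiff_partialDeriv k hf)
  · exact (contDiff_coord k).smul (contDiff_partialDeriv j hf)

/-- `fderiv` is additive only where both functions are differentiable, so the operator is linear on
smooth functions only. For this reason smoothness accompanies every later statement about its
iterates. -/
theorem angularDirac_add (hf : ContDiff ℝ ∞ f) (hg : ContDiff ℝ ∞ g) :
    angularDirac (f + g) = angularDirac f + angularDirac g := by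
  have hd : ∀ j, partialDeriv j (f + g) = partialDeriv j f + partialDeriv j g := by
    intro j
    funext y
    simp only [partialDeriv, Pi.add_apply]
    rw [fderiv_add (hf.differentiable (by simp) y) (hg.differentiable (by simp) y)]
    rfl
  funext y
  simp only [angularDirac, hd, Pi.add_apply]
  rw [← neg_add, ← Finset.sum_add_distrib]
  congr 1
  refine Finset.sum_congr rfl fun j _ => ?_
  rw [← Finset.sum_add_distrib]
  refine Finset.sum_congr rfl fun k _ => ?_
  rw [← mul_add]
  congr 1
  module

theorem angularDirac_smul (c : ℂ) (hf : ContDiff ℝ ∞ f) :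
    angularDirac (c • f) = c • angularDirac f := by
  have hd : ∀ j, partialDeriv j (c • f) = c • partialDeriv j f := by
    intro j
    funext y
    simp only [partialDeriv, Pi.smul_apply]
    rw [fderiv_const_smul (hf.differentiable (by simp) y)]
    rfl
  funext y
  simp only [angularDirac, hd, Pi.smul_apply]
  rw [smul_neg, Finset.smul_sum]
  congr 1
  refine Finset.sum_congr rfl fun j _ => ?_
  rw [Finset.smul_sum]
  refine Finset.sum_congr rfl fun k _ => ?_
  rw [← mul_smul_comm]
  congr 1
  module

theorem contDiff_gammaSqExponent (hf : ContDiff ℝ ∞ f) : ContDiff ℝ ∞ (gammaSqExponent f) :=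
  (contDiff_angularDirac (contDiff_angularDirac hf)).const_smul _

theorem gammaSqExponent_add (hf : ContDiff ℝ ∞ f) (hg : ContDiff ℝ ∞ g) :
    gammaSqExponent (f + g) = gammaSqExponent f + gammaSqExponent g := by
  funext y
  simp only [gammaSqExponent, Pi.add_apply]
  rw [angularDirac_add hf hg, angularDirac_add (contDiff_angularDirac hf) (contDiff_angularDirac hg),
    Pi.add_apply, smul_add]

theorem gammaSqExponent_smul (c : ℂ) (hf : ContDiff ℝ ∞ f) :
    gammaSqExponent (c • f) = c • gammaSqExponent f := by
  funext y
  simp only [gammaSqExponent, Pi.smul_apply]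
  rw [angularDirac_smul c hf, angularDirac_smul c (contDiff_angularDirac hf),
    Pi.smul_apply, smul_comm]

theorem contDiff_iterate_gammaSqExponent (n : ℕ) (hf : ContDiff ℝ ∞ f) :
    ContDiff ℝ ∞ (gammaSqExponent^[n] f) := by
  induction n with
  | zero => exact hf
  | succ n ih => rw [Function.iterate_succ_apply']; exact contDiff_gammaSqExponent ih

theorem iterate_gammaSqExponent_add (n : ℕ) (hf : ContDiff ℝ ∞ f) (hg : ContDiff ℝ ∞ g) :
    gammaSqExponent^[n] (f + g) = gammaSqExponent^[n] f + gammaSqExponent^[n] g := by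
  induction n with
  | zero => rfl
  | succ n ih =>
    simp only [Function.iterate_succ_apply']
    rw [ih, gammaSqExponent_add (contDiff_iterate_gammaSqExponent n hf)
      (contDiff_iterate_gammaSqExponent n hg)]

theorem iterate_gammaSqExponent_smul (n : ℕ) (c : ℂ) (hf : ContDiff ℝ ∞ f) :
    gammaSqExponent^[n] (c • f) = c • gammaSqExponent^[n] f := by
  induction n with
  | zero => rfl
  | succ n ih =>
    simp only [Function.iterate_succ_apply']
    rw [ih, gammaSqExponent_smul c (contDiff_iterate_gammaSqExponent n hf)]

theorem expTerm_add (hf : ContDiff ℝ ∞ f) (hg : ContDiff ℝ ∞ g)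
    (y : EuclideanSpace ℝ (Fin m)) (n : ℕ) :
    expTerm gammaSqExponent (f + g) y n =
      expTerm gammaSqExponent f y n + expTerm gammaSqExponent g y n := by
  simp only [expTerm]
  rw [iterate_gammaSqExponent_add n hf hg, Pi.add_apply, smul_add]

theorem expTerm_smul (c : ℂ) (hf : ContDiff ℝ ∞ f) (y : EuclideanSpace ℝ (Fin m)) (n : ℕ) :
    expTerm gammaSqExponent (c • f) y n = c • expTerm gammaSqExponent f y n := by
  simp only [expTerm]
  rw [iterate_gammaSqExponent_smul n c hf, Pi.smul_apply, smul_comm]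

/-- The span of the smooth eigenfunctions of the Gamma operator whose eigenvalues are integers of
the parity of `ε`. -/
noncomputable def paritySpace (m : ℕ) (ε : ℤ) :
    Submodule ℂ (EuclideanSpace ℝ (Fin m) → ComplexClifford m) :=
  Submodule.span ℂ {p | ContDiff ℝ ∞ p ∧ ∃ k : ℤ, Even (k - ε) ∧ angularDirac p = (k : ℂ) • p}

/-- The value of `e^{iπk²/2}` for integers `k` of the parity of `ε`. -/
noncomputable def parityPhase (ε : ℤ) : ℂ := Complex.exp (Complex.I * (Real.pi / 2) * (ε : ℂ) ^ 2)

theorem parityPhase_eq_of_even {k ε : ℤ} (h : Even (k - ε)) : parityPhase k = parityPhase ε := by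
  obtain ⟨d, hd⟩ := h
  have hk : (k : ℂ) = ε + 2 * d := by
    rw [show k = ε + 2 * d by omega]; push_cast; ring
  rw [parityPhase, parityPhase, Complex.exp_eq_exp_iff_exists_int]
  -- With k = ε + 2d one has k² = ε² + 4(εd + d²), so the exponents iπk²/2 and iπε²/2 differ by
  -- 2πi(εd + d²).
  refine ⟨ε * d + d ^ 2, ?_⟩
  rw [hk]; push_cast; ring

theorem paritySpace_eq_of_even {k ε : ℤ} (h : Even (k - ε)) :
    paritySpace m k = paritySpace m ε := by
  have : ∀ n : ℤ, Even (n - k) ↔ Even (n - ε) := by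
    intro n
    rw [show n - ε = (n - k) + (k - ε) by ring, Int.even_add]
    simp [h]
  simp only [paritySpace, this]

/-- On one eigenfunction the series is the scalar exponential series at iπk²/2, whose sum depends
only on the parity of k. All generators therefore receive the same scalar, and the statement extends
linearly to their span without a choice of decomposition. -/
theorem expTerm_of_mem_paritySpace {ε : ℤ} (hf : f ∈ paritySpace m ε) :
    ContDiff ℝ ∞ f ∧ ∀ y, (Summable fun n => ‖expTerm gammaSqExponent f y n‖) ∧
      HasSum (expTerm gammaSqExponent f y) (parityPhase ε • f y) := by
  induction hf using Submodule.span_induction with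
  | mem p hp =>
    obtain ⟨hp, k, hk, hkp⟩ := hp
    refine ⟨hp, fun y => ?_⟩
    set μ : ℂ := Complex.I * (Real.pi / 2) * (k : ℂ) ^ 2 with hμ
    have hT : gammaSqExponent p = μ • p := by
      funext z
      simp only [gammaSqExponent]
      rw [hkp, angularDirac_smul _ hp, hkp, hμ]
      simp only [Pi.smul_apply, smul_smul]
      congr 1; ring
    have hTn : ∀ n, gammaSqExponent^[n] p = μ ^ n • p := by
      intro n
      induction n with
      | zero => simp
      | succ n ih =>
        rw [Function.iterate_succ_apply', ih, gammaSqExponent_smul _ hp, hT, smul_smul, pow_succ]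
    have hterm : ∀ n, expTerm gammaSqExponent p y n = (μ ^ n / n.factorial) • p y := by
      intro n
      rw [expTerm, hTn, Pi.smul_apply, smul_smul]
      congr 1; rw [div_eq_inv_mul]
    constructor
    · simp only [hterm, norm_smul, norm_div, norm_pow, Complex.norm_natCast]
      exact (Real.summable_pow_div_factorial ‖μ‖).mul_right _
    · have h : HasSum (fun n : ℕ => μ ^ n / n.factorial) (Complex.exp μ) := by
        rw [Complex.exp_eq_exp_ℂ]
        exact NormedSpace.expSeries_div_hasSum_exp μ
      have h' := h.smul_const (p y)
      rw [← parityPhase_eq_of_even hk, parityPhase, ← hμ]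
      simpa only [← hterm] using h'
  | zero =>
    refine ⟨contDiff_const, fun y => ?_⟩
    have h0 : ∀ n, expTerm (m := m) gammaSqExponent 0 y n = 0 := by
      intro n
      have h := expTerm_smul (m := m) 0 (f := 0) contDiff_const y n
      rwa [zero_smul, zero_smul] at h
    simp only [h0, norm_zero, Pi.zero_apply, smul_zero]
    exact ⟨summable_zero, hasSum_zero.congr_fun (by simp [h0])⟩
  | add p q _ _ hp hq =>
    refine ⟨hp.1.add hq.1, fun y => ?_⟩
    have h := expTerm_add hp.1 hq.1 y
    constructor
    · refine Summable.of_nonneg_of_le (fun _ => norm_nonneg _) (fun n => ?_)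
        ((hp.2 y).1.add (hq.2 y).1)
      rw [h]; exact norm_add_le _ _
    · rw [Pi.add_apply, smul_add, funext h]
      exact (hp.2 y).2.add (hq.2 y).2
  | smul c p _ hp =>
    refine ⟨hp.1.const_smul c, fun y => ?_⟩
    have h := expTerm_smul c hp.1 y
    constructor
    · simp only [h, norm_smul]
      exact (hp.2 y).1.mul_left _
    · rw [Pi.smul_apply, smul_comm, funext h]
      exact (hp.2 y).2.const_smul c

end Operator

end PlaneWaveSpectrum

namespace PlaneWaveSpectrum

open ComplexClifford
open scoped ContDiff

variable {m : ℕ}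

/-! ### Functions of (x,y) and |y|, and the zonal eigenfunctions of Gamma -/

/-- The scalar function `F` is smooth, and the rotations `y_j ∂_k - y_k ∂_j` act on it as on a
function of `(x,y)` and `|y|` whose derivative with respect to `(x,y)` is `F'`. -/
structure HasAngularDeriv (x : EuclideanSpace ℝ (Fin m)) (F F' : EuclideanSpace ℝ (Fin m) → ℂ) :
    Prop where
  contDiff : ContDiff ℝ ∞ F
  rotation : ∀ y j k, (y j : ℂ) * fderiv ℝ F y (EuclideanSpace.single k 1)
    - y k * fderiv ℝ F y (EuclideanSpace.single j 1) = (y j * x k - y k * x j) * F' y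

namespace HasAngularDeriv

variable {x : EuclideanSpace ℝ (Fin m)} {F F' G G' : EuclideanSpace ℝ (Fin m) → ℂ}

theorem hasFDerivAt (hF : HasAngularDeriv x F F') (y : EuclideanSpace ℝ (Fin m)) :
    HasFDerivAt F (fderiv ℝ F y) y :=
  (hF.contDiff.differentiable (by simp) y).hasFDerivAt

theorem const (x : EuclideanSpace ℝ (Fin m)) (c : ℂ) :
    HasAngularDeriv x (fun _ => c) (fun _ => 0) :=
  ⟨contDiff_const, by simp⟩

theorem add (hF : HasAngularDeriv x F F') (hG : HasAngularDeriv x G G') :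
    HasAngularDeriv x (fun y => F y + G y) (fun y => F' y + G' y) := by
  refine ⟨hF.contDiff.add hG.contDiff, fun y j k => ?_⟩
  have h : fderiv ℝ (fun y => F y + G y) y = fderiv ℝ F y + fderiv ℝ G y :=
    ((hF.hasFDerivAt y).add (hG.hasFDerivAt y)).fderiv
  rw [h]
  simp only [add_apply]
  linear_combination hF.rotation y j k + hG.rotation y j k

theorem mul (hF : HasAngularDeriv x F F') (hG : HasAngularDeriv x G G') :
    HasAngularDeriv x (fun y => F y * G y) (fun y => F' y * G y + F y * G' y) := by
  refine ⟨hF.contDiff.mul hG.contDiff, fun y j k => ?_⟩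
  have h : fderiv ℝ (fun y => F y * G y) y = F y • fderiv ℝ G y + G y • fderiv ℝ F y :=
    ((hF.hasFDerivAt y).mul (hG.hasFDerivAt y)).fderiv
  rw [h]
  simp only [add_apply, smul_apply, smul_eq_mul]
  linear_combination G y * hF.rotation y j k + F y * hG.rotation y j k

theorem const_mul (c : ℂ) (hF : HasAngularDeriv x F F') :
    HasAngularDeriv x (fun y => c * F y) (fun y => c * F' y) := by
  simpa using (const x c).mul hF

theorem of_innerC (x : EuclideanSpace ℝ (Fin m)) :
    HasAngularDeriv x (fun y => innerC x y) (fun _ => 1) where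
  contDiff := (Complex.ofRealCLM.comp (innerSL ℝ x)).contDiff
  rotation y j k := by
    have h : fderiv ℝ (fun y => innerC x y) y
        = Complex.ofRealCLM.comp (innerSL ℝ x) :=
      (Complex.ofRealCLM.comp (innerSL ℝ x)).hasFDerivAt.fderiv
    rw [h]
    simp [EuclideanSpace.inner_single_right]

/-- Rotations annihilate |y|². The squared norm is used because it is smooth at the origin, where
|y| is not. -/
theorem of_normSq (x : EuclideanSpace ℝ (Fin m)) :
    HasAngularDeriv x (fun y => ((‖x‖ : ℂ) * ‖y‖) ^ 2) (fun _ => 0) := by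
  have h0 : HasAngularDeriv x (fun y => ((‖y‖ ^ 2 : ℝ) : ℂ)) (fun _ => 0) := by
    refine ⟨Complex.ofRealCLM.contDiff.comp (contDiff_norm_sq ℝ), fun y j k => ?_⟩
    have h : fderiv ℝ (fun y : EuclideanSpace ℝ (Fin m) => ((‖y‖ ^ 2 : ℝ) : ℂ)) y
        = Complex.ofRealCLM.comp (2 • innerSL ℝ y) :=
      (Complex.ofRealCLM.hasFDerivAt.comp y (hasStrictFDerivAt_norm_sq y).hasFDerivAt).fderiv
    rw [h]
    simp [EuclideanSpace.inner_single_right]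
    ring
  have h := h0.const_mul ((‖x‖ : ℂ) ^ 2)
  simpa [mul_pow] using h

theorem radialPow (x : EuclideanSpace ℝ (Fin m)) (c : ℂ) (i : ℕ) :
    HasAngularDeriv x (fun y => c * ((‖x‖ : ℂ) * ‖y‖) ^ (2 * i)) (fun _ => 0) := by
  refine (HasAngularDeriv.const_mul c (F' := fun _ => 0) ?_ : _) |> fun h => by simpa using h
  induction i with
  | zero => simpa using const x 1
  | succ i ih =>
    have h := ih.mul (of_normSq x)
    simpa [pow_succ, mul_add, ← mul_assoc] using h

/-- This is where `gegenbauerDeriv` is shown to act as the derivative in (x,y). Applying the product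
rule to the three-term recurrence of the polynomials gives `gegenbauerDeriv_three_term`, so the
property propagates by two-step induction. -/
theorem of_gegenbauer (x : EuclideanSpace ℝ (Fin m)) (l : ℂ) (k : ℕ) :
    HasAngularDeriv x
      (fun y => gegenbauer l (innerC x y)
        (((‖x‖ : ℂ) * ‖y‖) ^ 2) k)
      (fun y => gegenbauerDeriv l (innerC x y) (((‖x‖ : ℂ) * ‖y‖) ^ 2) k) := by
  induction k using Nat.twoStepInduction with
  | zero => simpa using const x 1
  | one =>
    simpa [gegenbauer_one, gegenbauerDeriv_succ] using (of_innerC x).const_mul (2 * l)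
  | more k ih0 ih1 =>
    have hk : (k : ℂ) + 2 ≠ 0 := by norm_cast
    have h := (((of_innerC x).mul ih1).const_mul (2 * (k + 1 + l))).add
      (((of_normSq x).mul ih0).const_mul (-(k + 2 * l)))
    have h' := h.const_mul (k + 2 : ℂ)⁻¹
    convert h' using 1
    · funext y
      have := gegenbauer_three_term l (innerC x y) (((‖x‖ : ℂ) * ‖y‖) ^ 2) k
      generalize ((‖x‖ : ℂ) * ‖y‖) ^ 2 = N at *
      field_simp
      linear_combination this
    · funext y
      have := gegenbauerDeriv_three_term l (innerC x y) (((‖x‖ : ℂ) * ‖y‖) ^ 2) k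
      generalize ((‖x‖ : ℂ) * ‖y‖) ^ 2 = N at *
      field_simp
      linear_combination this

end HasAngularDeriv

/-- The function `y ↦ F(y) + H(y) yx`. -/
noncomputable def zonal (x : EuclideanSpace ℝ (Fin m)) (F H : EuclideanSpace ℝ (Fin m) → ℂ) :
    EuclideanSpace ℝ (Fin m) → ComplexClifford m :=
  fun y => F y • 1 + H y • (vec y * vec x)

/-- The map `y ↦ yx`. -/
noncomputable def vecMulCLM (x : EuclideanSpace ℝ (Fin m)) :
    EuclideanSpace ℝ (Fin m) →L[ℝ] ComplexClifford m :=
  ((LinearMap.mulRight ℂ (vec x)).restrictScalars ℝ ∘ₗ vecLinear m).toContinuousLinearMap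

theorem vecMulCLM_apply (x y : EuclideanSpace ℝ (Fin m)) : vecMulCLM x y = vec y * vec x := rfl

section Zonal

variable {x : EuclideanSpace ℝ (Fin m)} {F F' H H' : EuclideanSpace ℝ (Fin m) → ℂ}

theorem contDiff_zonal (hF : ContDiff ℝ ∞ F) (hH : ContDiff ℝ ∞ H) :
    ContDiff ℝ ∞ (zonal x F H) :=
  (hF.smul (contDiff_const (c := (1 : ComplexClifford m)))).add (hH.smul (vecMulCLM x).contDiff)

theorem partialDeriv_zonal (hF : HasAngularDeriv x F F') (hH : HasAngularDeriv x H H')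
    (j : Fin m) (y : EuclideanSpace ℝ (Fin m)) :
    partialDeriv j (zonal x F H) y =
      fderiv ℝ F y (EuclideanSpace.single j 1) • 1
        + fderiv ℝ H y (EuclideanSpace.single j 1) • (vec y * vec x) + H y • (e j * vec x) := by
  have h1 := (hF.hasFDerivAt y).smul (hasFDerivAt_const (1 : ComplexClifford m) y)
  have h2 := (hH.hasFDerivAt y).smul (vecMulCLM x).hasFDerivAt
  have h : fderiv ℝ (zonal x F H) y = _ := (h1.add h2).fderiv
  rw [partialDeriv, h]
  simp only [add_apply, smul_apply,
    ContinuousLinearMap.smulRight_apply, smul_zero, zero_add,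
    vecMulCLM_apply, e]
  abel

/-- The Gamma operator on functions `F + H yx`. -/
theorem angularDirac_zonal (hF : HasAngularDeriv x F F') (hH : HasAngularDeriv x H H') :
    angularDirac (zonal x F H) =
      zonal x (fun y => -innerC x y * F' y + ((‖x‖ : ℂ) * ‖y‖) ^ 2 * H' y)
        (fun y => -F' y + innerC x y * H' y + (m - 1) * H y) := by
  funext y
  have hterm : ∀ j k, (e j * e k * ((y j : ℂ) • partialDeriv k (zonal x F H) y
      - (y k : ℂ) • partialDeriv j (zonal x F H) y) : ComplexClifford m) =
      (((y j : ℂ) * x k - y k * x j) • (e j * e k)) * (F' y • 1 + H' y • (vec y * vec x)) +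
      H y • ((e j * e k * ((y j : ℂ) • e k - (y k : ℂ) • e j)) * vec x) := by
    intro j k
    have h1 := hF.rotation y j k
    have h2 := hH.rotation y j k
    have h3 : (y j : ℂ) • partialDeriv k (zonal x F H) y
        - (y k : ℂ) • partialDeriv j (zonal x F H) y =
        ((y j * x k - y k * x j : ℂ) * F' y) • 1 +
        ((y j * x k - y k * x j : ℂ) * H' y) • (vec y * vec x) +
        H y • (((y j : ℂ) • e k - (y k : ℂ) • e j) * vec x) := by
      rw [partialDeriv_zonal hF hH, partialDeriv_zonal hF hH, ← h1, ← h2, sub_mul,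
        smul_mul_assoc, smul_mul_assoc]
      module
    rw [h3]
    simp only [mul_add, mul_smul_comm, smul_mul_assoc, smul_smul, mul_one, mul_assoc]
    congr 1
    congr 1
    · congr 1; ring
    · congr 1; ring
  simp only [angularDirac, hterm, Finset.sum_add_distrib, ← Finset.sum_mul, ← Finset.smul_sum]
  rw [sum_e_mul_e_smul, sum_e_mul_e_mul]
  -- What remains is -(yx + (x,y))(F' + H' yx) + (m - 1) H yx. The quadratic relation for yx brings
  -- it back to the span of 1 and yx.
  have hq := vec_mul_vec_sq x y
  simp only [zonal, add_mul, mul_add, mul_smul_comm, smul_mul_assoc, mul_one, one_mul, neg_mul, hq,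
    smul_neg, smul_add, smul_sub, smul_smul]
  module

theorem angularDirac_radial_smul {φ : EuclideanSpace ℝ (Fin m) → ℂ}
    {p : EuclideanSpace ℝ (Fin m) → ComplexClifford m}
    (hφ : HasAngularDeriv x φ fun _ => 0) (hp : ContDiff ℝ ∞ p) :
    angularDirac (fun y => φ y • p y) = fun y => φ y • angularDirac p y := by
  have hd : ∀ j y, partialDeriv j (fun y => φ y • p y) y =
      φ y • partialDeriv j p y + fderiv ℝ φ y (EuclideanSpace.single j 1) • p y := by
    intro j y
    have h : fderiv ℝ (fun y => φ y • p y) y = _ :=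
      ((hφ.hasFDerivAt y).smul (hp.differentiable (by simp) y).hasFDerivAt).fderiv
    rw [partialDeriv, h]
    rfl
  funext y
  simp only [angularDirac, hd, smul_neg, Finset.smul_sum]
  congr 1
  refine Finset.sum_congr rfl fun j _ => Finset.sum_congr rfl fun k _ => ?_
  rw [← mul_smul_comm]
  congr 1
  have h := hφ.rotation y j k
  rw [mul_zero] at h
  have h' : ((y j : ℂ) * fderiv ℝ φ y (EuclideanSpace.single k 1)
    - y k * fderiv ℝ φ y (EuclideanSpace.single j 1)) • p y = 0 := by rw [h, zero_smul]
  rw [sub_smul] at h'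
  rw [← sub_eq_zero, ← h']
  module

end Zonal

theorem radial_smul_mem_paritySpace {ε : ℤ} {x : EuclideanSpace ℝ (Fin m)}
    {φ : EuclideanSpace ℝ (Fin m) → ℂ} {p : EuclideanSpace ℝ (Fin m) → ComplexClifford m}
    (hφ : HasAngularDeriv x φ fun _ => 0) (hp : p ∈ paritySpace m ε) :
    (fun y => φ y • p y) ∈ paritySpace m ε := by
  induction hp using Submodule.span_induction with
  | mem p hp =>
    obtain ⟨hp, k, hk, hkp⟩ := hp
    refine Submodule.subset_span ⟨hφ.contDiff.smul hp, k, hk, ?_⟩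
    rw [angularDirac_radial_smul hφ hp, hkp]
    funext y
    simp only [Pi.smul_apply]
    rw [smul_comm]
  | zero =>
    convert (paritySpace m ε).zero_mem using 1
    funext y
    simp
  | add p q _ _ hp hq =>
    convert (paritySpace m ε).add_mem hp hq using 1
    funext y
    simp
  | smul c p _ hp =>
    convert (paritySpace m ε).smul_mem c hp using 1
    funext y
    simp only [Pi.smul_apply]
    rw [smul_comm]

open PowerSeries in
-- The function C_k + C_{k-1} yx is an eigenfunction with eigenvalue -k, as for a monogenic of
-- degree k. Its scalar component is `mul_gegenbauerDeriv_succ_sub` and its bivector component is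
-- `gegenbauerDeriv_succ`. The choice l = m/2 is what matches the term (m - 1)H.
theorem zonal_gegenbauer_mem_paritySpace (x : EuclideanSpace ℝ (Fin m)) (k : ℕ) :
    zonal x
      (fun y => coeff k (gegenbauerSeries (m / 2) (innerC x y) (((‖x‖ : ℂ) * ‖y‖) ^ 2)))
      (fun y => coeff k (X * gegenbauerSeries (m / 2) (innerC x y) (((‖x‖ : ℂ) * ‖y‖) ^ 2)))
      ∈ paritySpace m k := by
  have hF := HasAngularDeriv.of_gegenbauer x (m / 2) k
  rcases k with _ | k
  · have h : ∀ y, coeff 0 (X * gegenbauerSeries (m / 2) (innerC x y) (((‖x‖ : ℂ) * ‖y‖) ^ 2)) = 0 :=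
      fun y => by simp
    simp only [gegenbauerSeries, coeff_mk] at h ⊢
    simp only [h]
    refine Submodule.subset_span ⟨contDiff_zonal hF.contDiff contDiff_const, 0, by simp, ?_⟩
    rw [angularDirac_zonal hF (HasAngularDeriv.const x 0)]
    simp [zonal, funext_iff]
  · have hH := HasAngularDeriv.of_gegenbauer x (m / 2) k
    simp only [coeff_succ_X_mul, gegenbauerSeries, coeff_mk]
    refine Submodule.subset_span ⟨contDiff_zonal hF.contDiff hH.contDiff, -(k + 1 : ℕ), ?_, ?_⟩
    · exact ⟨-(k + 1 : ℕ), by ring⟩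
    · rw [angularDirac_zonal hF hH]
      funext y
      have h1 := mul_gegenbauerDeriv_succ_sub (m / 2) (innerC x y) (((‖x‖ : ℂ) * ‖y‖) ^ 2) k
      have h2 := gegenbauerDeriv_succ (m / 2) (innerC x y) (((‖x‖ : ℂ) * ‖y‖) ^ 2) k
      simp only [zonal, Pi.smul_apply, smul_add, smul_smul]
      congr 2
      · push_cast; linear_combination -h1
      · push_cast; linear_combination -h2

open PowerSeries in
-- For k ≥ 1 the function r² C_{k-2} + C_{k-1} yx has eigenvalue k + m - 2, as for y times a
-- monogenic of degree k - 1. The same two Gegenbauer relations are used with their roles exchanged.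
theorem zonal_gegenbauer_mul_mem_paritySpace (x : EuclideanSpace ℝ (Fin m)) (k : ℕ) :
    zonal x
      (fun y => coeff k (C (((‖x‖ : ℂ) * ‖y‖) ^ 2) * X ^ 2 *
        gegenbauerSeries (m / 2) (innerC x y) (((‖x‖ : ℂ) * ‖y‖) ^ 2)))
      (fun y => coeff k (X * gegenbauerSeries (m / 2) (innerC x y) (((‖x‖ : ℂ) * ‖y‖) ^ 2)))
      ∈ paritySpace m (k + m) := by
  simp only [mul_assoc, coeff_C_mul]
  rcases k with _ | _ | k
  · simp only [coeff_X_pow_mul', gegenbauerSeries]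
    simp only [coeff_zero_X_mul, nonpos_iff_eq_zero, OfNat.ofNat_ne_zero, if_false, mul_zero]
    convert (paritySpace m ((0 : ℕ) + m)).zero_mem using 1
    funext y
    simp [zonal]
  -- In degree one the scalar component is absent and the function is yx itself, with eigenvalue m -
  -- 1.
  · have hH := HasAngularDeriv.of_gegenbauer x (m / 2) 0
    simp only [coeff_X_pow_mul', coeff_succ_X_mul, gegenbauerSeries, coeff_mk]
    norm_num only [if_false, mul_zero]
    refine Submodule.subset_span ⟨contDiff_zonal contDiff_const hH.contDiff, m - 1, ?_, ?_⟩
    · exact ⟨-1, by push_cast; ring⟩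
    · rw [angularDirac_zonal (HasAngularDeriv.const x 0) hH]
      funext y
      simp [zonal]
  · have hF := (HasAngularDeriv.of_normSq x).mul (HasAngularDeriv.of_gegenbauer x (m / 2) k)
    have hH := HasAngularDeriv.of_gegenbauer x (m / 2) (k + 1)
    simp only [show k + 1 + 1 = k + 2 from rfl, coeff_X_pow_mul]
    simp only [show k + 2 = k + 1 + 1 from rfl, coeff_succ_X_mul, gegenbauerSeries, coeff_mk]
    refine Submodule.subset_span ⟨contDiff_zonal hF.contDiff hH.contDiff, k + m, ?_, ?_⟩
    · exact ⟨-1, by push_cast; ring⟩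
    · rw [angularDirac_zonal hF hH]
      funext y
      have h1 := mul_gegenbauerDeriv_succ_sub (m / 2) (innerC x y) (((‖x‖ : ℂ) * ‖y‖) ^ 2) k
      have h2 := gegenbauerDeriv_succ (m / 2) (innerC x y) (((‖x‖ : ℂ) * ‖y‖) ^ 2) k
      simp only [zonal, Pi.smul_apply, smul_add, smul_smul]
      congr 2
      · push_cast; linear_combination (((‖x‖ : ℂ) * ‖y‖) ^ 2) * h2
      · push_cast; linear_combination h1

end PlaneWaveSpectrum

namespace PlaneWaveSpectrum

open ComplexClifford PowerSeries
open scoped ContDiff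

variable {m : ℕ}

/-! ### Splitting the plane wave degree by degree -/

/-- The component, in the span of the functions `|y|^{2j} M` with `M` monogenic, of a multiple of
`(x,y)^K`. -/
noncomputable def plusPart (x : EuclideanSpace ℝ (Fin m)) (K : ℕ) :
    EuclideanSpace ℝ (Fin m) → ComplexClifford m :=
  zonal x (fun y => coeff K (scalarPartSeries (m / 2) (innerC x y) ((‖x‖ : ℂ) * ‖y‖)))
    (fun y => coeff K (bivectorPartSeries (m / 2) (innerC x y) ((‖x‖ : ℂ) * ‖y‖)))

/-- The component, in the span of the functions `|y|^{2j} y M` with `M` monogenic, of a multiple of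
`(x,y)^K`. -/
noncomputable def minusPart (x : EuclideanSpace ℝ (Fin m)) (K : ℕ) :
    EuclideanSpace ℝ (Fin m) → ComplexClifford m :=
  zonal x
    (fun y => coeff K (risingSeries (m / 2) (innerC x y) -
      scalarPartSeries (m / 2) (innerC x y) ((‖x‖ : ℂ) * ‖y‖)))
    (fun y => -coeff K (bivectorPartSeries (m / 2) (innerC x y) ((‖x‖ : ℂ) * ‖y‖)))

/-- The radial factor has only even powers of r as coefficients. These commute with Γ, and
multiplying by them shifts the degree by an even amount, so the parity of the eigenvalues still
matches the total degree. -/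
theorem sum_radial_smul_mem_paritySpace (x : EuclideanSpace ℝ (Fin m)) (l : ℂ) (δ : ℤ)
    {Z : ℕ → EuclideanSpace ℝ (Fin m) → ComplexClifford m}
    (hZ : ∀ k : ℕ, Z k ∈ paritySpace m (k + δ)) (n : ℕ) :
    (fun y => ∑ p ∈ Finset.HasAntidiagonal.antidiagonal n,
      coeff p.1 (radialSeries l ((‖x‖ : ℂ) * ‖y‖)) • Z p.2 y) ∈ paritySpace m (n + δ) := by
  have h : (fun y => ∑ p ∈ Finset.HasAntidiagonal.antidiagonal n,
      coeff p.1 (radialSeries l ((‖x‖ : ℂ) * ‖y‖)) • Z p.2 y) =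
      ∑ p ∈ Finset.HasAntidiagonal.antidiagonal n,
        fun y => coeff p.1 (radialSeries l ((‖x‖ : ℂ) * ‖y‖)) • Z p.2 y := by
    funext y; simp
  rw [h]
  refine Submodule.sum_mem _ fun p hp => ?_
  rw [Finset.HasAntidiagonal.mem_antidiagonal] at hp
  have hr : ∀ y : EuclideanSpace ℝ (Fin m), coeff p.1 (radialSeries l ((‖x‖ : ℂ) * ‖y‖)) =
      coeff p.1 (radialSeries l 1) * ((‖x‖ : ℂ) * ‖y‖) ^ p.1 := fun y => by
    rw [coeff_radialSeries, mul_comm]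
  simp only [hr]
  rcases Nat.even_or_odd p.1 with he | ho
  · rw [paritySpace_eq_of_even (ε := p.2 + δ)]
    · obtain ⟨i, hi⟩ := he
      have hφ := HasAngularDeriv.radialPow x (coeff p.1 (radialSeries l 1)) i
      rw [show 2 * i = p.1 by omega] at hφ
      exact radial_smul_mem_paritySpace hφ (hZ p.2)
    · obtain ⟨i, hi⟩ := he
      exact ⟨i, by omega⟩
  · simp only [coeff_radialSeries_of_odd l ho, zero_mul, zero_smul]
    exact (paritySpace m _).zero_mem

/-- The coefficient of v^n after substitution involves only the coefficients of u^K with K ≤ n. The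
diagonal entry is the nonzero constant 2^n and the other entries are radial, vanishing when n - K is
odd. Strong induction therefore solves for the last coefficient without leaving the parity space. -/
theorem mem_paritySpace_of_triangular (x : EuclideanSpace ℝ (Fin m)) (δ : ℤ)
    {a : ℕ → EuclideanSpace ℝ (Fin m) → ComplexClifford m}
    (ha : ∀ n : ℕ, (fun y => ∑ K ∈ Finset.range (n + 1),
      (uniformizerCoeff n K * ((‖x‖ : ℂ) * ‖y‖) ^ (n - K)) • a K y) ∈ paritySpace m (n + δ))
    (n : ℕ) : a n ∈ paritySpace m (n + δ) := by
  induction n using Nat.strong_induction_on with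
  | _ n ih =>
    have h1 : (∑ K ∈ Finset.range n, fun y =>
        (uniformizerCoeff n K * ((‖x‖ : ℂ) * ‖y‖) ^ (n - K)) • a K y) ∈ paritySpace m (n + δ) := by
      refine Submodule.sum_mem _ fun K hK => ?_
      rw [Finset.mem_range] at hK
      rcases Nat.even_or_odd (n - K) with he | ho
      · obtain ⟨i, hi⟩ := he
        have hφ := HasAngularDeriv.radialPow x (uniformizerCoeff n K) i
        rw [show 2 * i = n - K by omega] at hφ
        rw [paritySpace_eq_of_even (ε := K + δ) ⟨i, by omega⟩]
        exact radial_smul_mem_paritySpace hφ (ih K hK)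
      · simp only [uniformizerCoeff_of_odd ho, zero_mul, zero_smul]
        exact (paritySpace m _).zero_mem
    have h2 := Submodule.smul_mem _ (uniformizerCoeff n n)⁻¹ (Submodule.sub_mem _ (ha n) h1)
    convert h2 using 1
    funext y
    simp [Finset.sum_range_succ, smul_smul, inv_mul_cancel₀ (uniformizerCoeff_self n)]

/-- In the variable v the generating series of these functions is the radial factor times that of
the eigenfunctions C_k + C_{k-1} yx; the triangular argument transfers the conclusion back to u. -/
theorem plusPart_mem_paritySpace (x : EuclideanSpace ℝ (Fin m)) (K : ℕ) :
    plusPart x K ∈ paritySpace m K := by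
  have h := mem_paritySpace_of_triangular x 0 (a := plusPart x) (fun n => ?_) K
  · simpa using h
  have h := sum_radial_smul_mem_paritySpace x (m / 2) 0
    (fun k => by simpa using zonal_gegenbauer_mem_paritySpace x k) n
  convert h using 1
  funext y
  have h1 := congrArg (coeff n)
    (scalarPartSeries_subst (m / 2) (innerC x y) ((‖x‖ : ℂ) * ‖y‖))
  have h2 := congrArg (coeff n)
    (bivectorPartSeries_subst (m / 2) (innerC x y) ((‖x‖ : ℂ) * ‖y‖))
  rw [coeff_subst_uniformizer, coeff_mul] at h1 h2
  simp only [plusPart, zonal, smul_add, Finset.sum_add_distrib, smul_smul, ← Finset.sum_smul,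
    h1, h2]

theorem minusPart_mem_paritySpace (x : EuclideanSpace ℝ (Fin m)) (K : ℕ) :
    minusPart x K ∈ paritySpace m (K + m) := by
  refine mem_paritySpace_of_triangular x m (a := minusPart x) (fun n => ?_) K
  have h := (paritySpace m (n + m)).neg_mem <| sum_radial_smul_mem_paritySpace x (m / 2) m
    (fun k => zonal_gegenbauer_mul_mem_paritySpace x k) n
  convert h using 1
  funext y
  have h1 := congrArg (coeff n)
    (risingSeries_sub_scalarPartSeries_subst (m / 2) (innerC x y) ((‖x‖ : ℂ) * ‖y‖))
  have h2 := congrArg (coeff n)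
    (bivectorPartSeries_subst (m / 2) (innerC x y) ((‖x‖ : ℂ) * ‖y‖))
  rw [map_neg] at h1
  rw [coeff_subst_uniformizer, coeff_mul] at h1 h2
  simp only [minusPart, zonal, smul_add, Finset.sum_add_distrib, smul_smul, ← Finset.sum_smul,
    h1, h2, smul_neg, Finset.sum_neg_distrib, Pi.neg_apply, neg_add, neg_smul]

theorem plusPart_add_minusPart (x y : EuclideanSpace ℝ (Fin m)) (K : ℕ) :
    plusPart x K y + minusPart x K y = (risingCoeff (m / 2) K * innerC x y ^ K) • 1 := by
  have h : coeff K (risingSeries (m / 2) (innerC x y)) =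
      risingCoeff (m / 2) K * innerC x y ^ K := by
    rw [risingSeries, coeff_mk]
  rw [plusPart, minusPart, zonal, zonal, ← h, map_sub]
  module

theorem iteratedDeriv_exp_mul_smul (c : ℂ) (v : ComplexClifford m) (k : ℕ) :
    iteratedDeriv k (fun r : ℝ => Complex.exp (c * r) • v) =
      fun r : ℝ => (c ^ k * Complex.exp (c * r)) • v := by
  induction k with
  | zero => simp
  | succ k ih =>
    rw [iteratedDeriv_succ, ih]
    funext r
    have h1 : HasDerivAt (fun r : ℝ => c ^ k * Complex.exp (c * r))
        (c ^ k * (Complex.exp (c * r) * (c * 1))) r := by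
      have h0 : HasDerivAt (fun z : ℂ => Complex.exp (c * z)) (Complex.exp (c * r) * (c * 1)) r :=
        ((hasDerivAt_id (r : ℂ)).const_mul c).cexp
      exact (h0.comp_ofReal).const_mul _
    rw [(h1.smul_const v).deriv]
    congr 1; ring

theorem homogeneousPart_planeWave (x : EuclideanSpace ℝ (Fin m)) (t : ℝ) (k : ℕ) :
    homogeneousPart k (planeWave x t) =
      fun y => ((-Complex.I * t) ^ k / k.factorial * innerC x y ^ k) • 1 := by
  funext y
  have h : (fun r : ℝ => planeWave x t (r • y)) =
      fun r : ℝ => Complex.exp ((-Complex.I * t * innerC x y) * r) • (1 : ComplexClifford m) := by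
    funext r
    rw [planeWave, Algebra.algebraMap_eq_smul_one, real_inner_smul_right, innerC]
    congr 2; push_cast; ring
  rw [homogeneousPart, h, iteratedDeriv_exp_mul_smul]
  simp only [Complex.ofReal_zero, mul_zero, Complex.exp_zero, mul_one, smul_smul]
  congr 1; rw [mul_pow]; ring

theorem risingCoeff_ne_zero (hm : 1 ≤ m) (n : ℕ) : risingCoeff (m / 2) n ≠ 0 := by
  induction n with
  | zero => exact one_ne_zero
  | succ n ih =>
    refine mul_ne_zero (div_ne_zero ?_ (Nat.cast_add_one_ne_zero n)) ih
    have h : ((m : ℂ) / 2 + n) = ((m + 2 * n : ℕ) : ℂ) / 2 := by push_cast; ring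
    rw [h]
    refine div_ne_zero ?_ two_ne_zero
    exact_mod_cast (by omega : m + 2 * n ≠ 0)

/-- The normalization of the degree `K` part of the plane wave. -/
noncomputable def waveCoeff (m : ℕ) (t : ℝ) (K : ℕ) : ℂ :=
  (-Complex.I * t) ^ K / (K.factorial * risingCoeff (m / 2) K)

/-- The degree K part of the plane wave is a multiple of (x,y)^K, hence `waveCoeff` times the sum of
the two components. On each of them the exponential is one scalar phase. -/
theorem expTerm_homogeneousPart (hm : 1 ≤ m) (x y : EuclideanSpace ℝ (Fin m)) (t : ℝ) (K : ℕ) :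
    (Summable fun n => ‖expTerm gammaSqExponent (homogeneousPart K (planeWave x t)) y n‖) ∧
      ∑' n, expTerm gammaSqExponent (homogeneousPart K (planeWave x t)) y n =
        waveCoeff m t K • (parityPhase K • plusPart x K y
          + parityPhase (K + m) • minusPart x K y) := by
  have hdec : homogeneousPart K (planeWave x t) =
      waveCoeff m t K • plusPart x K + waveCoeff m t K • minusPart x K := by
    rw [homogeneousPart_planeWave, ← smul_add]
    funext y
    rw [Pi.smul_apply, Pi.add_apply, plusPart_add_minusPart, smul_smul, waveCoeff]
    have h1 := risingCoeff_ne_zero hm K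
    have h2 : (K.factorial : ℂ) ≠ 0 := by exact_mod_cast K.factorial_ne_zero
    congr 1
    field_simp
  obtain ⟨hp, hps⟩ := expTerm_of_mem_paritySpace
    ((paritySpace m K).smul_mem (waveCoeff m t K) (plusPart_mem_paritySpace x K))
  obtain ⟨hq, hqs⟩ := expTerm_of_mem_paritySpace
    ((paritySpace m (K + m)).smul_mem (waveCoeff m t K) (minusPart_mem_paritySpace x K))
  rw [hdec]
  have h := expTerm_add hp hq y
  constructor
  · refine Summable.of_nonneg_of_le (fun _ => norm_nonneg _) (fun n => ?_)
      ((hps y).1.add (hqs y).1)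
    rw [h]; exact norm_add_le _ _
  · rw [funext h, ((hps y).2.add (hqs y).2).tsum_eq]
    simp only [Pi.smul_apply, smul_add]
    rw [smul_comm, smul_comm (parityPhase (K + m))]

end PlaneWaveSpectrum

namespace PlaneWaveSpectrum

open MeasureTheory Set Filter Topology

/-! ### The Gamma integral on the right half-plane -/

section GammaIntegral

theorem norm_rpow_mul_exp (lam : ℝ) (z : ℂ) {t : ℝ} (ht : 0 < t) :
    ‖((t ^ (lam - 1) : ℝ) : ℂ) * Complex.exp (-z * t)‖ = t ^ (lam - 1) * Real.exp (-z.re * t) := by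
  rw [norm_mul, Complex.norm_real, Real.norm_of_nonneg (Real.rpow_nonneg ht.le _), Complex.norm_exp]
  simp

theorem aestronglyMeasurable_rpow_mul_exp (lam : ℝ) (z : ℂ) (μ : Measure ℝ) :
    AEStronglyMeasurable (fun t : ℝ => ((t ^ (lam - 1) : ℝ) : ℂ) * Complex.exp (-z * t)) μ :=
  (by fun_prop : Measurable fun t : ℝ =>
    ((t ^ (lam - 1) : ℝ) : ℂ) * Complex.exp (-z * t)).aestronglyMeasurable

theorem integrableOn_rpow_mul_exp {lam : ℝ} (hl : 0 < lam) {b : ℝ} (hb : 0 < b) :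
    IntegrableOn (fun t : ℝ => t ^ (lam - 1) * Real.exp (-b * t)) (Ioi 0) := by
  simpa using integrableOn_rpow_mul_exp_neg_mul_rpow (p := 1) (s := lam - 1) (by linarith)
    one_pos hb

theorem integrableOn_rpow_mul_cexp {lam : ℝ} (hl : 0 < lam) {z : ℂ} (hz : 0 < z.re) :
    IntegrableOn (fun t : ℝ => ((t ^ (lam - 1) : ℝ) : ℂ) * Complex.exp (-z * t)) (Ioi 0) := by
  refine Integrable.mono' (integrableOn_rpow_mul_exp hl hz)
    (aestronglyMeasurable_rpow_mul_exp lam z _) ?_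
  filter_upwards [ae_restrict_mem measurableSet_Ioi] with t ht
  exact (norm_rpow_mul_exp lam z ht).le

theorem differentiableAt_integral_rpow_mul_cexp {lam : ℝ} (hl : 0 < lam) {z : ℂ} (hz : 0 < z.re) :
    DifferentiableAt ℂ
      (fun z : ℂ => ∫ t : ℝ in Ioi 0, ((t ^ (lam - 1) : ℝ) : ℂ) * Complex.exp (-z * t)) z := by
  have hs : {ζ : ℂ | z.re / 2 < ζ.re} ∈ 𝓝 z :=
    (isOpen_lt continuous_const Complex.continuous_re).mem_nhds (by simp; linarith)
  -- Differentiating in z brings down a factor t, which raises the exponent by one. The rate Re z /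
  -- 2 dominates uniformly near z.
  have hb := integrableOn_rpow_mul_exp (lam := lam + 1) (by linarith) (half_pos hz)
  refine (hasDerivAt_integral_of_dominated_loc_of_deriv_le
    (μ := volume.restrict (Ioi (0 : ℝ)))
    (F := fun z t => ((t ^ (lam - 1) : ℝ) : ℂ) * Complex.exp (-z * t))
    (F' := fun z t => ((t ^ (lam - 1) : ℝ) : ℂ) * (Complex.exp (-z * t) * (-1 * t)))
    hs ?_ (integrableOn_rpow_mul_cexp hl hz) ?_ ?_ hb ?_).2.differentiableAt
  · exact Eventually.of_forall fun ζ => aestronglyMeasurable_rpow_mul_exp lam ζ _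
  · exact (by fun_prop : Measurable fun t : ℝ =>
      ((t ^ (lam - 1) : ℝ) : ℂ) * (Complex.exp (-z * t) * (-1 * t))).aestronglyMeasurable
  · filter_upwards [ae_restrict_mem measurableSet_Ioi] with t ht ζ hζ
    have ht : 0 < t := ht
    have h1 : ‖((t ^ (lam - 1) : ℝ) : ℂ) * (Complex.exp (-ζ * t) * (-1 * t))‖ =
        ‖((t ^ (lam - 1) : ℝ) : ℂ) * Complex.exp (-ζ * t)‖ * t := by
      rw [← mul_assoc, norm_mul, norm_mul (-1 : ℂ), Complex.norm_real, Real.norm_of_nonneg ht.le]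
      simp
    rw [h1, norm_rpow_mul_exp lam ζ ht, add_sub_cancel_right]
    have h2 : t ^ lam = t ^ (lam - 1) * t := by
      rw [← Real.rpow_add_one ht.ne']; congr 1; ring
    rw [h2]
    have h3 : Real.exp (-ζ.re * t) ≤ Real.exp (-(z.re / 2) * t) := by
      apply Real.exp_le_exp.mpr
      have : z.re / 2 < ζ.re := hζ
      nlinarith
    have h4 : 0 ≤ t ^ (lam - 1) * t := by positivity
    nlinarith
  · filter_upwards with t ζ _
    have h0 : HasDerivAt (fun ζ : ℂ => -ζ * (t : ℂ)) (-1 * t) ζ :=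
      ((hasDerivAt_id ζ).neg).mul_const _
    exact (h0.cexp).const_mul _

/-- Both sides are analytic on the right half-plane and agree on the positive real axis, so the
identity theorem applies. The points 1 + 1/(n+1) supply the accumulation at 1. -/
theorem integral_rpow_mul_cexp {lam : ℝ} (hl : 0 < lam) {z : ℂ} (hz : 0 < z.re) :
    ∫ t : ℝ in Ioi 0, ((t ^ (lam - 1) : ℝ) : ℂ) * Complex.exp (-z * t) =
      Complex.Gamma lam * (z ^ (lam : ℂ))⁻¹ := by
  have hU : IsOpen {ζ : ℂ | 0 < ζ.re} := isOpen_lt continuous_const Complex.continuous_re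
  have hslit : ∀ ζ : ℂ, 0 < ζ.re → ζ ∈ Complex.slitPlane := fun ζ h => Or.inl h
  have hf : AnalyticOnNhd ℂ
      (fun z : ℂ => ∫ t : ℝ in Ioi 0, ((t ^ (lam - 1) : ℝ) : ℂ) * Complex.exp (-z * t))
      {ζ : ℂ | 0 < ζ.re} :=
    DifferentiableOn.analyticOnNhd (fun ζ hζ =>
      (differentiableAt_integral_rpow_mul_cexp hl hζ).differentiableWithinAt) hU
  have hg : AnalyticOnNhd ℂ (fun z : ℂ => Complex.Gamma lam * (z ^ (lam : ℂ))⁻¹)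
      {ζ : ℂ | 0 < ζ.re} := by
    refine DifferentiableOn.analyticOnNhd (fun ζ hζ => DifferentiableAt.differentiableWithinAt ?_) hU
    have hζ0 : ζ ≠ 0 := Complex.slitPlane_ne_zero (hslit ζ hζ)
    refine DifferentiableAt.const_mul (DifferentiableAt.inv ?_ ?_) _
    · exact differentiableAt_id.cpow_const (hslit ζ hζ)
    · simp [Complex.cpow_eq_zero_iff, hζ0]
  have hreal : ∀ r : ℝ, 0 < r →
      ∫ t : ℝ in Ioi 0, ((t ^ (lam - 1) : ℝ) : ℂ) * Complex.exp (-(r : ℂ) * t) =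
        Complex.Gamma lam * ((r : ℂ) ^ (lam : ℂ))⁻¹ := by
    intro r hr
    have h := Complex.integral_cpow_mul_exp_neg_mul_Ioi (a := lam) (by simpa using hl) hr
    have h1 : (1 / (r : ℂ)) ^ (lam : ℂ) = ((r : ℂ) ^ (lam : ℂ))⁻¹ := by
      rw [one_div, Complex.inv_cpow]
      rw [Complex.arg_ofReal_of_nonneg hr.le]; exact Real.pi_pos.ne
    rw [h1, mul_comm] at h
    rw [← h]
    refine setIntegral_congr_fun measurableSet_Ioi fun t ht => ?_
    have ht : 0 < t := ht
    rw [Complex.ofReal_cpow ht.le, neg_mul]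
    push_cast
    rfl
  refine hf.eqOn_of_preconnected_of_frequently_eq hg (convex_halfSpace_re_gt 0).isPreconnected
    (z₀ := 1) (by simp) ?_ hz
  have hlim : Tendsto (fun n : ℕ => ((1 + 1 / ((n : ℝ) + 1) : ℝ) : ℂ)) atTop (𝓝[≠] 1) := by
    refine tendsto_nhdsWithin_iff.mpr ⟨?_, Eventually.of_forall fun n => ?_⟩
    · have h := (tendsto_one_div_add_atTop_nhds_zero_nat (𝕜 := ℝ)).const_add 1
      have h' := (Complex.continuous_ofReal.tendsto _).comp h
      simpa [Function.comp_def] using h'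
    · have : (0 : ℝ) < 1 / ((n : ℝ) + 1) := by positivity
      intro h
      have h2 : (1 + 1 / ((n : ℝ) + 1) : ℝ) = 1 := by
        rw [mem_singleton_iff] at h; exact_mod_cast h
      linarith
  exact hlim.frequently (Frequently.of_forall fun n => hreal _ (by positivity))

end GammaIntegral

/-! ### The Bessel kernel as a circle average, and its Laplace transform -/

section CosineKernel

/-- The average over the circle of `(i r cos θ)^ε e^{i r x cos θ}`: the Bessel function `J₀(r x)` for
`ε = 0`, and its derivative in `x` for `ε = 1`. -/
noncomputable def cosKernel (r : ℝ) (ε : ℕ) (x : ℝ) : ℂ :=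
  ((2 * Real.pi : ℝ) : ℂ)⁻¹ * ∫ θ : ℝ in (0)..(2 * Real.pi),
    (Complex.I * r * Real.cos θ) ^ ε * Complex.exp (Complex.I * r * Real.cos θ * x)

/-- The moments of `i r cos θ` on the circle. -/
noncomputable def cosMoment (r : ℝ) (n : ℕ) : ℂ :=
  ((2 * Real.pi : ℝ) : ℂ)⁻¹ * ∫ θ : ℝ in (0)..(2 * Real.pi), (Complex.I * r * Real.cos θ) ^ n

theorem norm_I_mul_cos_le (r θ : ℝ) : ‖Complex.I * r * Real.cos θ‖ ≤ |r| := by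
  rw [norm_mul, norm_mul, Complex.norm_I, one_mul, Complex.norm_real, Complex.norm_real]
  exact mul_le_of_le_one_right (abs_nonneg r) (Real.abs_cos_le_one θ)

theorem norm_cosMoment_le (r : ℝ) (n : ℕ) : ‖cosMoment r n‖ ≤ |r| ^ n := by
  have hpi : (0 : ℝ) < 2 * Real.pi := by positivity
  have h : ‖∫ θ : ℝ in (0)..(2 * Real.pi), (Complex.I * r * Real.cos θ) ^ n‖ ≤
      |r| ^ n * |2 * Real.pi - 0| := by
    refine intervalIntegral.norm_integral_le_of_norm_le_const fun θ _ => ?_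
    rw [norm_pow]
    exact pow_le_pow_left₀ (norm_nonneg _) (norm_I_mul_cos_le r θ) n
  rw [sub_zero, abs_of_pos hpi] at h
  rw [cosMoment, norm_mul, norm_inv, Complex.norm_real, Real.norm_of_nonneg hpi.le]
  calc (2 * Real.pi)⁻¹ * _ ≤ (2 * Real.pi)⁻¹ * (|r| ^ n * (2 * Real.pi)) := by gcongr
    _ = |r| ^ n := by field_simp

/-- Wallis' recursion for ∫ cos^n over a period has ratio (n+1)/(n+2), which is the recursion of the
coefficients of (1 - u²)^{-1/2}. This links the Bessel kernel to the generating series. -/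
theorem cosMoment_eq (r : ℝ) (n : ℕ) :
    cosMoment r n = Complex.I ^ n * (r : ℂ) ^ n * evenCoeff (1 / 2) n := by
  have hpi : ((2 * Real.pi : ℝ) : ℂ) ≠ 0 := by
    exact_mod_cast (by positivity : (2 * Real.pi : ℝ) ≠ 0)
  have h : ∀ n : ℕ, ((∫ θ : ℝ in (0)..(2 * Real.pi), Real.cos θ ^ n : ℝ) : ℂ) =
      ((2 * Real.pi : ℝ) : ℂ) * evenCoeff (1 / 2) n := by
    intro n
    induction n using Nat.twoStepInduction with
    | zero => simp [evenCoeff]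
    | one => simp [evenCoeff]
    | more n ih _ =>
      rw [integral_cos_pow, evenCoeff]
      simp only [Real.sin_two_pi, Real.sin_zero, mul_zero, sub_zero, zero_div, zero_add]
      push_cast at ih ⊢
      rw [ih]; ring
  have h1 : ∀ θ : ℝ, (Complex.I * r * Real.cos θ) ^ n =
      (Complex.I ^ n * (r : ℂ) ^ n) * ((Real.cos θ ^ n : ℝ) : ℂ) := by
    intro θ; push_cast; ring
  rw [cosMoment]
  simp only [h1]
  rw [intervalIntegral.integral_const_mul, intervalIntegral.integral_ofReal, h]
  field_simp

theorem hasSum_cosKernel (r : ℝ) (ε : ℕ) (x : ℝ) :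
    HasSum (fun n : ℕ => cosMoment r (n + ε) * (x : ℂ) ^ n / n.factorial) (cosKernel r ε x) := by
  have hpi : (0 : ℝ) ≤ 2 * Real.pi := by positivity
  set F : ℕ → ℝ → ℂ := fun n θ =>
    (Complex.I * r * Real.cos θ) ^ (n + ε) * ((x : ℂ) ^ n / n.factorial) with hF
  have hcont : ∀ n, Continuous (F n) := by intro n; fun_prop
  have hint : ∀ n, Integrable (F n) (volume.restrict (Ioc 0 (2 * Real.pi))) := fun n =>
    ((hcont n).intervalIntegrable 0 (2 * Real.pi)).1
  have hbound : ∀ n θ, ‖F n θ‖ ≤ |r| ^ ε * ((|r| * |x|) ^ n / n.factorial) := by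
    intro n θ
    have h := pow_le_pow_left₀ (norm_nonneg _) (norm_I_mul_cos_le r θ) (n + ε)
    rw [hF]
    simp only [norm_mul, norm_div, norm_pow, Complex.norm_real, Complex.norm_natCast,
      Real.norm_eq_abs] at h ⊢
    calc _ ≤ |r| ^ (n + ε) * (|x| ^ n / n.factorial) := by gcongr
      _ = _ := by rw [pow_add, mul_pow]; ring
  have hsum : Summable fun n => ∫ θ in Ioc 0 (2 * Real.pi), ‖F n θ‖ := by
    refine Summable.of_nonneg_of_le (fun n => integral_nonneg fun _ => norm_nonneg _) (fun n => ?_)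
      (((Real.summable_pow_div_factorial (|r| * |x|)).mul_left (|r| ^ ε)).mul_left (2 * Real.pi))
    calc ∫ θ in Ioc 0 (2 * Real.pi), ‖F n θ‖
        ≤ ∫ θ in Ioc 0 (2 * Real.pi), |r| ^ ε * ((|r| * |x|) ^ n / n.factorial) :=
          integral_mono (hint n).norm (integrable_const _) (hbound n)
      _ = _ := by simp [hpi]
  have h := (hasSum_integral_of_summable_integral_norm hint hsum).mul_left
    (((2 * Real.pi : ℝ) : ℂ)⁻¹)
  have hk : cosKernel r ε x =
      ((2 * Real.pi : ℝ) : ℂ)⁻¹ * ∫ θ in Ioc 0 (2 * Real.pi), ∑' n, F n θ := by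
    rw [cosKernel, intervalIntegral.integral_of_le hpi]
    congr 2
    funext θ
    have h1 : HasSum (fun n : ℕ => (Complex.I * r * Real.cos θ * x) ^ n / n.factorial)
        (Complex.exp (Complex.I * r * Real.cos θ * x)) := by
      rw [Complex.exp_eq_exp_ℂ]
      exact NormedSpace.expSeries_div_hasSum_exp _
    rw [← (h1.mul_left ((Complex.I * r * Real.cos θ) ^ ε)).tsum_eq]
    refine tsum_congr fun n => ?_
    rw [hF]
    simp only
    rw [mul_pow, pow_add]; ring
  rw [hk]
  refine h.congr_fun fun n => ?_
  rw [← intervalIntegral.integral_of_le hpi, hF]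
  simp only
  rw [intervalIntegral.integral_mul_const, cosMoment]
  ring

/-- The exponential e^{irx cos θ} has modulus one, so Fubini applies for every Re s > 0 and each
angle contributes an elementary exponential integral. -/
theorem laplace_cosKernel (r : ℝ) (ε : ℕ) {s : ℂ} (hs : 0 < s.re) :
    IntegrableOn (fun x : ℝ => Complex.exp (-s * x) * cosKernel r ε x) (Ioi 0) ∧
      ∫ x : ℝ in Ioi 0, Complex.exp (-s * x) * cosKernel r ε x =
        ((2 * Real.pi : ℝ) : ℂ)⁻¹ * ∫ θ : ℝ in (0)..(2 * Real.pi),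
          (Complex.I * r * Real.cos θ) ^ ε / (s - Complex.I * r * Real.cos θ) := by
  have hpi : (0 : ℝ) ≤ 2 * Real.pi := by positivity
  set G : ℝ → ℝ → ℂ := fun x θ => Complex.exp (-s * x) *
    ((Complex.I * r * Real.cos θ) ^ ε * Complex.exp (Complex.I * r * Real.cos θ * x)) with hG
  have hGc : Continuous (Function.uncurry G) := by
    rw [hG]; simp only [Function.uncurry_def]; fun_prop
  have hexp : IntegrableOn (fun x : ℝ => Real.exp (-s.re * x)) (Ioi 0) := by
    simpa using integrableOn_rpow_mul_exp one_pos hs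
  have hGi : Integrable (Function.uncurry G)
      ((volume.restrict (Ioi 0)).prod (volume.restrict (Ioc 0 (2 * Real.pi)))) := by
    refine Integrable.mono' (Integrable.mul_prod (f := fun x : ℝ => Real.exp (-s.re * x))
      (g := fun _ : ℝ => |r| ^ ε) hexp (integrable_const _)) hGc.aestronglyMeasurable
      (Eventually.of_forall fun p => ?_)
    obtain ⟨x, θ⟩ := p
    have h1 : ‖Complex.exp (Complex.I * r * Real.cos θ * x)‖ = 1 := by
      rw [show Complex.I * r * Real.cos θ * x = ((r * Real.cos θ * x : ℝ) : ℂ) * Complex.I by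
        push_cast; ring]
      exact Complex.norm_exp_ofReal_mul_I _
    have h2 : ‖Complex.exp (-s * x)‖ = Real.exp (-s.re * x) := by
      rw [Complex.norm_exp]; simp
    simp only [Function.uncurry_apply_pair, hG, norm_mul (Complex.exp _), h2,
      norm_mul ((Complex.I * r * Real.cos θ) ^ ε), h1, norm_pow, mul_one]
    gcongr
    exact norm_I_mul_cos_le r θ
  have hker : ∀ x : ℝ, Complex.exp (-s * x) * cosKernel r ε x =
      ((2 * Real.pi : ℝ) : ℂ)⁻¹ * ∫ θ in Ioc 0 (2 * Real.pi), G x θ := by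
    intro x
    rw [cosKernel, intervalIntegral.integral_of_le hpi, hG]
    simp only
    rw [integral_const_mul]
    ring
  simp only [hker]
  refine ⟨hGi.integral_prod_left.const_mul _, ?_⟩
  rw [integral_const_mul, integral_integral_swap hGi, intervalIntegral.integral_of_le hpi]
  congr 2
  funext θ
  have h3 : ∀ x : ℝ, G x θ = (Complex.I * r * Real.cos θ) ^ ε *
      Complex.exp ((-(s - Complex.I * r * Real.cos θ)) * x) := by
    intro x
    rw [hG]
    simp only
    rw [mul_left_comm, ← Complex.exp_add]
    congr 2; ring
  have h4 : (s - Complex.I * r * Real.cos θ).re = s.re := by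
    simp [Complex.mul_re, Complex.mul_im]
  simp only [h3]
  rw [integral_const_mul, integral_exp_mul_complex_Ioi (by rw [Complex.neg_re, h4]; linarith)]
  simp only [Complex.ofReal_zero, mul_zero, Complex.exp_zero, neg_div_neg_eq, mul_one_div]

/-- Mean value property of z ↦ 1/(1 - pz), which is holomorphic on a neighbourhood of the closed
unit disc and equals 1 at the centre. -/
theorem circle_average_inv_one_sub {p : ℂ} (hp : ‖p‖ < 1) :
    ∫ θ : ℝ in (0)..(2 * Real.pi), (1 - p * Complex.exp (θ * Complex.I))⁻¹ =
      ((2 * Real.pi : ℝ) : ℂ) := by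
  have hd : DiffContOnCl ℂ (fun z : ℂ => (1 - p * z)⁻¹) (Metric.ball 0 |1|) := by
    have hne : ∀ z ∈ Metric.closedBall (0 : ℂ) 1, 1 - p * z ≠ 0 := by
      intro z hz h
      rw [mem_closedBall_zero_iff] at hz
      have h1 : p * z = 1 := (sub_eq_zero.mp h).symm
      have h2 : ‖p‖ * ‖z‖ = 1 := by rw [← norm_mul, h1, norm_one]
      nlinarith [norm_nonneg p, norm_nonneg z]
    rw [abs_one]
    refine DifferentiableOn.diffContOnCl fun z hz => ?_
    rw [closure_ball _ one_ne_zero] at hz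
    exact (((differentiableAt_const 1).sub
      ((differentiableAt_const p).mul differentiableAt_id)).inv (hne z hz)).differentiableWithinAt
  have h := hd.circleAverage
  rw [Real.circleAverage_def] at h
  simp only [circleMap, zero_add, Complex.ofReal_one, one_mul, mul_zero, sub_zero, inv_one,
    Complex.real_smul] at h
  have hpi : ((2 * Real.pi : ℝ) : ℂ) ≠ 0 := by
    exact_mod_cast (by positivity : (2 * Real.pi : ℝ) ≠ 0)
  rw [Complex.ofReal_inv] at h
  field_simp at h
  simpa [one_div] using h

theorem circle_average_inv_one_sub_neg {p : ℂ} (hp : ‖p‖ < 1) :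
    ∫ θ : ℝ in (0)..(2 * Real.pi), (1 - p * Complex.exp (-θ * Complex.I))⁻¹ =
      ((2 * Real.pi : ℝ) : ℂ) := by
  have hper : Function.Periodic (fun θ : ℝ => (1 - p * Complex.exp (θ * Complex.I))⁻¹)
      (2 * Real.pi) := by
    intro θ
    simp only
    rw [Complex.ofReal_add, add_mul, Complex.exp_add]
    push_cast
    rw [Complex.exp_two_pi_mul_I, mul_one]
  have h1 := intervalIntegral.integral_comp_neg (a := 0) (b := 2 * Real.pi)
    (fun θ : ℝ => (1 - p * Complex.exp (θ * Complex.I))⁻¹)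
  have h2 := hper.intervalIntegral_add_eq (-(2 * Real.pi)) 0
  rw [neg_add_cancel, zero_add] at h2
  rw [neg_zero, h2, circle_average_inv_one_sub hp] at h1
  simpa using h1

theorem one_sub_mul_exp_ne_zero {p : ℂ} (hp : ‖p‖ < 1) (θ : ℝ) :
    1 - p * Complex.exp (θ * Complex.I) ≠ 0 := by
  intro h
  have h1 : p * Complex.exp (θ * Complex.I) = 1 := (sub_eq_zero.mp h).symm
  have h2 : ‖p‖ = 1 := by
    rw [← norm_one (α := ℂ), ← h1, norm_mul, Complex.norm_exp_ofReal_mul_I, mul_one]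
  linarith

/-- If `S² = s² + r²` and `S`, `s` lie in the right half-plane, then `1/S` is the average of
`1/(s - i r cos θ)`. -/
theorem circle_average_inv_sub_cos {r : ℝ} {s S : ℂ} (hs : 0 < s.re) (hS : 0 < S.re)
    (hsq : S ^ 2 = s ^ 2 + (r : ℂ) ^ 2) :
    ∫ θ : ℝ in (0)..(2 * Real.pi), (s - Complex.I * r * Real.cos θ)⁻¹ =
      ((2 * Real.pi : ℝ) : ℂ) * S⁻¹ := by
  -- Comparing imaginary parts of S² = s² + r² gives Re S · Im S = Re s · Im s, so the imaginary
  -- parts have the same sign. Hence Re(S s̄) > 0 and |S - s| < |S + s|.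
  have him : 0 ≤ S.im * s.im := by
    have h := congrArg Complex.im hsq
    simp only [pow_two, Complex.mul_im, Complex.add_im, Complex.ofReal_re, Complex.ofReal_im,
      mul_zero, zero_mul, add_zero] at h
    have h2 : S.re * S.im = s.re * s.im := by linarith
    have h3 : 0 ≤ S.re * (S.im * s.im) := by
      have : S.re * (S.im * s.im) = s.re * (s.im * s.im) := by
        rw [← mul_assoc, h2, mul_assoc]
      rw [this]
      exact mul_nonneg hs.le (mul_self_nonneg _)
    exact nonneg_of_mul_nonneg_right h3 hS
  have hsum0 : s + S ≠ 0 := by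
    intro h
    have := congrArg Complex.re h
    simp at this
    linarith
  have hS0 : S ≠ 0 := by rintro rfl; simp at hS
  have hlt : ‖S - s‖ ^ 2 < ‖s + S‖ ^ 2 := by
    rw [← Complex.normSq_eq_norm_sq, ← Complex.normSq_eq_norm_sq, Complex.normSq_apply,
      Complex.normSq_apply]
    simp only [Complex.sub_re, Complex.sub_im, Complex.add_re, Complex.add_im]
    nlinarith [mul_pos hs hS]
  -- Chosen so that 2(s - ir cos θ) = (s + S)(1 - p e^{iθ})(1 - p e^{-iθ}), because (s + S)p = ir
  -- and (s + S)p² = s - S. Also |p|² = |S - s|/|S + s| < 1. The pointwise identity below is then a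
  -- partial fraction decomposition of Poisson kernel type.
  set p : ℂ := Complex.I * r / (s + S) with hp
  have hp1 : ‖p‖ < 1 := by
    have h1 : ‖p‖ ^ 2 < 1 := by
      have h2 : ‖(r : ℂ)‖ ^ 2 = ‖S - s‖ * ‖s + S‖ := by
        rw [← norm_pow, ← norm_mul]
        congr 1
        linear_combination -hsq
      have h3 : 0 < ‖s + S‖ := norm_pos_iff.mpr hsum0
      have h4 : ‖S - s‖ < ‖s + S‖ := lt_of_pow_lt_pow_left₀ 2 h3.le hlt
      rw [hp, norm_div, norm_mul, Complex.norm_I, one_mul, div_pow, h2, div_lt_one (by positivity)]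
      nlinarith
    nlinarith [norm_nonneg p]
  have hpt : ∀ θ : ℝ, (s - Complex.I * r * Real.cos θ)⁻¹ =
      S⁻¹ * ((1 - p * Complex.exp (θ * Complex.I))⁻¹ + (1 - p * Complex.exp (-θ * Complex.I))⁻¹ - 1)
      := by
    intro θ
    have hA := one_sub_mul_exp_ne_zero hp1 θ
    have hB := one_sub_mul_exp_ne_zero hp1 (-θ)
    rw [Complex.ofReal_neg] at hB
    have hE : Complex.exp (θ * Complex.I) * Complex.exp (-θ * Complex.I) = 1 := by
      rw [← Complex.exp_add]; simp
    have hcos : (Real.cos θ : ℂ) =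
        (Complex.exp (θ * Complex.I) + Complex.exp (-θ * Complex.I)) / 2 := by
      rw [Complex.ofReal_cos, Complex.cos]
    have hc : (s + S) * p = Complex.I * r := by rw [hp]; field_simp
    have hp2 : (s + S) * p ^ 2 = s - S := by
      have : (s + S) * ((s + S) * p ^ 2) = (s + S) * (s - S) := by
        rw [show (s + S) * ((s + S) * p ^ 2) = ((s + S) * p) ^ 2 by ring, hc, mul_pow,
          Complex.I_sq]
        linear_combination hsq
      exact mul_left_cancel₀ hsum0 this
    have hden : 2 * (s - Complex.I * r * Real.cos θ) = (s + S) *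
        ((1 - p * Complex.exp (θ * Complex.I)) * (1 - p * Complex.exp (-θ * Complex.I))) := by
      rw [hcos]
      linear_combination (Complex.exp (θ * Complex.I) + Complex.exp (-θ * Complex.I)) * hc
        - (s + S) * p ^ 2 * hE - hp2
    have hne : s - Complex.I * r * Real.cos θ ≠ 0 := by
      intro h
      rw [h, mul_zero] at hden
      exact mul_ne_zero hsum0 (mul_ne_zero hA hB) hden.symm
    set A := 1 - p * Complex.exp (θ * Complex.I) with hAdef
    set B := 1 - p * Complex.exp (-θ * Complex.I) with hBdef
    have hAB : A + B - A * B = 1 - p ^ 2 := by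
      rw [hAdef, hBdef]; linear_combination -p ^ 2 * hE
    rw [inv_eq_iff_eq_inv]
    have h5 : S⁻¹ * (A⁻¹ + B⁻¹ - 1) = (A + B - A * B) / (S * (A * B)) := by field_simp; ring
    rw [h5, hAB, inv_div, eq_div_iff]
    · linear_combination (1 / 2 : ℂ) * (1 - p ^ 2) * hden - (1 / 2 : ℂ) * A * B * hp2
    · intro h6
      have h7 : (s + S) * (1 - p ^ 2) = 0 := by rw [h6, mul_zero]
      apply hS0
      linear_combination (1 / 2 : ℂ) * h7 + (1 / 2 : ℂ) * hp2
  have hcA : Continuous fun θ : ℝ => (1 - p * Complex.exp (θ * Complex.I))⁻¹ :=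
    Continuous.inv₀ (by fun_prop) (one_sub_mul_exp_ne_zero hp1)
  have hcB : Continuous fun θ : ℝ => (1 - p * Complex.exp (-θ * Complex.I))⁻¹ :=
    Continuous.inv₀ (by fun_prop) fun θ => by
      have := one_sub_mul_exp_ne_zero hp1 (-θ)
      rwa [Complex.ofReal_neg] at this
  simp only [hpt]
  rw [intervalIntegral.integral_const_mul, intervalIntegral.integral_sub,
    intervalIntegral.integral_add (hcA.intervalIntegrable _ _) (hcB.intervalIntegrable _ _),
    circle_average_inv_one_sub hp1, circle_average_inv_one_sub_neg hp1,
    intervalIntegral.integral_const]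
  · rw [sub_zero, Complex.real_smul]; ring
  · exact (hcA.add hcB).intervalIntegrable _ _
  · exact intervalIntegrable_const

end CosineKernel

end PlaneWaveSpectrum

namespace PlaneWaveSpectrum

open MeasureTheory Set Filter Topology

/-! ### Convolution with t^{lam-1} e^{zt} -/

section Convolution

theorem integral_rpow_mul_pow_mul_pow {lam : ℝ} (hl : 0 < lam) (n j : ℕ) {t : ℝ} (ht : 0 < t) :
    ∫ τ : ℝ in (0)..t, (t - τ : ℂ) ^ n * (((τ ^ (lam - 1) : ℝ) : ℂ) * (τ : ℂ) ^ j) =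
      ((t ^ (lam - 1) : ℝ) : ℂ) * (t : ℂ) ^ (n + j + 1) *
        (n.factorial * Complex.Gamma (lam + j) / Complex.Gamma (lam + (n + j + 1 : ℕ))) := by
  have ht0 : (t : ℂ) ≠ 0 := Complex.ofReal_ne_zero.mpr ht.ne'
  have h := Complex.betaIntegral_scaled (lam + j) (n + 1) ht
  have h1 : ∀ τ ∈ Ioc 0 t, (t - τ : ℂ) ^ n * (((τ ^ (lam - 1) : ℝ) : ℂ) * (τ : ℂ) ^ j) =
      (τ : ℂ) ^ ((lam + j : ℂ) - 1) * ((t : ℂ) - τ) ^ ((n + 1 : ℂ) - 1) := by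
    intro τ hτ
    have hτ0 : (τ : ℂ) ≠ 0 := Complex.ofReal_ne_zero.mpr hτ.1.ne'
    rw [add_sub_cancel_right, Complex.cpow_natCast, Complex.ofReal_cpow hτ.1.le,
      show (lam + j : ℂ) - 1 = ((lam - 1 : ℝ) : ℂ) + j by push_cast; ring,
      Complex.cpow_add _ _ hτ0, Complex.cpow_natCast]
    ring
  rw [intervalIntegral.integral_of_le ht.le, setIntegral_congr_fun measurableSet_Ioc h1,
    ← intervalIntegral.integral_of_le ht.le, h]
  have hre : 0 < ((lam : ℂ) + j).re := by simp; positivity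
  have hre' : 0 < ((n : ℂ) + 1).re := by simp; positivity
  have hB := Complex.Gamma_mul_Gamma_eq_betaIntegral hre hre'
  have hsum : (lam + j + (n + 1) : ℂ) = lam + (n + j + 1 : ℕ) := by push_cast; ring
  have hG : Complex.Gamma (lam + (n + j + 1 : ℕ)) ≠ 0 := by
    apply Complex.Gamma_ne_zero_of_re_pos
    simp only [Complex.add_re, Complex.ofReal_re, Complex.natCast_re]
    positivity
  rw [hsum, Complex.Gamma_nat_eq_factorial] at hB
  have hpow : (t : ℂ) ^ ((lam : ℂ) + j + (n + 1) - 1) =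
      ((t ^ (lam - 1) : ℝ) : ℂ) * (t : ℂ) ^ (n + j + 1) := by
    rw [Complex.ofReal_cpow ht.le, ← Complex.cpow_natCast, ← Complex.cpow_add _ _ ht0]
    congr 1; push_cast; ring
  rw [hpow]
  congr 1
  rw [eq_div_iff hG, mul_comm, ← hB, mul_comm]

set_option maxHeartbeats 400000 in
/-- Termwise integration of the convolution of a power series with `t^{lam-1} e^{zt}`. -/
theorem hasSum_convolution {lam : ℝ} (hl : 0 < lam) {κ : ℕ → ℂ} {c M : ℝ} (hM : 0 ≤ M)
    (hκ : ∀ n, ‖κ n‖ ≤ c * M ^ n) {k : ℝ → ℂ}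
    (hk : ∀ x : ℝ, HasSum (fun n : ℕ => κ n * (x : ℂ) ^ n / n.factorial) (k x)) (z : ℂ)
    {t : ℝ} (ht : 0 < t) :
    HasSum (fun K : ℕ => ((t ^ (lam - 1) : ℝ) : ℂ) * (t : ℂ) ^ (K + 1) /
        Complex.Gamma (lam + (K + 1 : ℕ)) *
        ∑ p ∈ Finset.HasAntidiagonal.antidiagonal K,
          κ p.1 * (z ^ p.2 * (Complex.Gamma (lam + p.2) / p.2.factorial)))
      (∫ τ : ℝ in (0)..t, k (t - τ) * (((τ ^ (lam - 1) : ℝ) : ℂ) * Complex.exp (z * τ))) := by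
  have hc : 0 ≤ c := by simpa using (norm_nonneg _).trans (hκ 0)
  have hrpow : IntervalIntegrable (fun τ : ℝ => τ ^ (lam - 1)) volume 0 t :=
    intervalIntegral.intervalIntegrable_rpow' (by linarith)
  set F : ℕ × ℕ → ℝ → ℂ := fun p τ => ((κ p.1 / p.1.factorial) * (z ^ p.2 / p.2.factorial)) *
    ((t - τ : ℂ) ^ p.1 * (((τ ^ (lam - 1) : ℝ) : ℂ) * (τ : ℂ) ^ p.2)) with hF
  have hint : ∀ p, Integrable (F p) (volume.restrict (Ioc 0 t)) := by
    intro p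
    have h1 : IntervalIntegrable (fun τ : ℝ => ((τ ^ (lam - 1) : ℝ) : ℂ)) volume 0 t :=
      ⟨hrpow.1.ofReal, hrpow.2.ofReal⟩
    have h2 := (h1.mul_continuousOn (g := fun τ : ℝ => (τ : ℂ) ^ p.2) (by fun_prop)).continuousOn_mul
      (g := fun τ : ℝ => (t - τ : ℂ) ^ p.1) (by fun_prop)
    exact (h2.const_mul _).1
  have hbound : ∀ p, ∀ τ ∈ Ioc 0 t, ‖F p τ‖ ≤
      (c * ((M * t) ^ p.1 / p.1.factorial) * ((‖z‖ * t) ^ p.2 / p.2.factorial)) *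
        τ ^ (lam - 1) := by
    intro p τ hτ
    have h1 : ‖(t - τ : ℂ)‖ ≤ t := by
      rw [← Complex.ofReal_sub, Complex.norm_real, Real.norm_of_nonneg (by linarith [hτ.2])]
      linarith [hτ.1]
    have h2 : ‖(τ : ℂ)‖ ≤ t := by
      rw [Complex.norm_real, Real.norm_of_nonneg hτ.1.le]; exact hτ.2
    have h3 : ‖((τ ^ (lam - 1) : ℝ) : ℂ)‖ = τ ^ (lam - 1) := by
      rw [Complex.norm_real, Real.norm_of_nonneg (Real.rpow_nonneg hτ.1.le _)]
    have h4 : 0 ≤ τ ^ (lam - 1) := Real.rpow_nonneg hτ.1.le _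
    simp only [hF, norm_mul, norm_div, norm_pow, Complex.norm_natCast, h3]
    calc ‖κ p.1‖ / p.1.factorial * (‖z‖ ^ p.2 / p.2.factorial) *
          (‖(t - τ : ℂ)‖ ^ p.1 * (τ ^ (lam - 1) * ‖(τ : ℂ)‖ ^ p.2))
        ≤ (c * M ^ p.1) / p.1.factorial * (‖z‖ ^ p.2 / p.2.factorial) *
          (t ^ p.1 * (τ ^ (lam - 1) * t ^ p.2)) := by
          have := hκ p.1
          gcongr
      _ = _ := by rw [mul_pow, mul_pow]; ring
  have hsum : Summable fun p => ∫ τ in Ioc 0 t, ‖F p τ‖ := by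
    have h1 : Summable fun p : ℕ × ℕ =>
        (c * ((M * t) ^ p.1 / p.1.factorial)) * ((‖z‖ * t) ^ p.2 / p.2.factorial) :=
      Summable.mul_of_nonneg ((Real.summable_pow_div_factorial (M * t)).mul_left c)
        (Real.summable_pow_div_factorial (‖z‖ * t))
        (fun n => by positivity) (fun n => by positivity)
    refine Summable.of_nonneg_of_le (fun p => integral_nonneg fun _ => norm_nonneg _) (fun p => ?_)
      (h1.mul_right (∫ τ in Ioc 0 t, τ ^ (lam - 1)))
    rw [← integral_const_mul]
    exact setIntegral_mono_on (hint p).norm (hrpow.1.const_mul _) measurableSet_Ioc (hbound p)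
  have h := hasSum_integral_of_summable_integral_norm hint hsum
  have hlim : ∫ τ : ℝ in (0)..t, k (t - τ) * (((τ ^ (lam - 1) : ℝ) : ℂ) * Complex.exp (z * τ)) =
      ∫ τ in Ioc 0 t, ∑' p, F p τ := by
    rw [intervalIntegral.integral_of_le ht.le]
    congr 1
    funext τ
    have hk' := hk (t - τ)
    have he : HasSum (fun n : ℕ => (z * τ) ^ n / n.factorial) (Complex.exp (z * τ)) := by
      rw [Complex.exp_eq_exp_ℂ]
      exact NormedSpace.expSeries_div_hasSum_exp _
    rw [mul_left_comm, ← hk'.tsum_eq, ← he.tsum_eq,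
      tsum_mul_tsum_of_summable_norm hk'.summable.norm he.summable.norm, ← tsum_mul_left]
    refine tsum_congr fun p => ?_
    rw [hF]
    simp only
    push_cast
    rw [mul_pow]; ring
  rw [hlim]
  -- The absolutely convergent double series over (n, j) is regrouped by total degree K = n + j. By
  -- the beta integral the power of t and the Gamma denominator depend on K only.
  have h' := (Finset.HasAntidiagonal.sigmaAntidiagonalEquivProd.hasSum_iff).mpr h
  refine h'.sigma fun K => ?_
  have hfin := hasSum_fintype fun p : Finset.HasAntidiagonal.antidiagonal K =>
    ((fun i => ∫ τ in Ioc 0 t, F i τ) ∘ Finset.HasAntidiagonal.sigmaAntidiagonalEquivProd) ⟨K, p⟩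
  have heq : ∑ p : Finset.HasAntidiagonal.antidiagonal K, ∫ τ in Ioc 0 t, F p τ =
      ((t ^ (lam - 1) : ℝ) : ℂ) * (t : ℂ) ^ (K + 1) / Complex.Gamma (lam + (K + 1 : ℕ)) *
        ∑ p ∈ Finset.HasAntidiagonal.antidiagonal K,
          κ p.1 * (z ^ p.2 * (Complex.Gamma (lam + p.2) / p.2.factorial)) := by
    rw [Finset.mul_sum, Finset.sum_coe_sort (Finset.HasAntidiagonal.antidiagonal K)
      fun p => ∫ τ in Ioc 0 t, F p τ]
    refine Finset.sum_congr rfl fun p hp => ?_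
    obtain ⟨n, j⟩ := p
    rw [Finset.HasAntidiagonal.mem_antidiagonal] at hp
    simp only at hp
    subst hp
    rw [hF]
    simp only
    rw [integral_const_mul, ← intervalIntegral.integral_of_le ht.le,
      integral_rpow_mul_pow_mul_pow hl n j ht]
    have hn : (n.factorial : ℂ) ≠ 0 := by exact_mod_cast n.factorial_ne_zero
    generalize Complex.Gamma (lam + (n + j + 1 : ℕ)) = A
    calc _ = ((t ^ (lam - 1) : ℝ) : ℂ) * (t : ℂ) ^ (n + j + 1) / A *
          (κ n * (z ^ j * (Complex.Gamma (lam + j) / j.factorial))) *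
          ((n.factorial : ℂ) * (n.factorial : ℂ)⁻¹) := by ring
      _ = _ := by rw [mul_inv_cancel₀ hn, mul_one]
  rw [← heq]
  exact hfin

/-- The Laplace transform of a convolution with `t^{lam-1} e^{zt}`. -/
theorem laplace_convolution {lam : ℝ} (hl : 0 < lam) {k : ℝ → ℂ} {s z : ℂ} (hs : 0 < (s - z).re)
    (hk : IntegrableOn (fun x : ℝ => Complex.exp (-s * x) * k x) (Ioi 0)) :
    IntegrableOn (fun t : ℝ => Complex.exp (-s * t) *
        ∫ τ : ℝ in (0)..t, k (t - τ) * (((τ ^ (lam - 1) : ℝ) : ℂ) * Complex.exp (z * τ))) (Ioi 0) ∧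
      ∫ t : ℝ in Ioi 0, Complex.exp (-s * t) *
        ∫ τ : ℝ in (0)..t, k (t - τ) * (((τ ^ (lam - 1) : ℝ) : ℂ) * Complex.exp (z * τ)) =
      (∫ x : ℝ in Ioi 0, Complex.exp (-s * x) * k x) *
        (Complex.Gamma lam * ((s - z) ^ (lam : ℂ))⁻¹) := by
  set f : ℝ → ℂ := fun τ => ((τ ^ (lam - 1) : ℝ) : ℂ) * Complex.exp (-(s - z) * τ) with hf
  set g : ℝ → ℂ := fun x => Complex.exp (-s * x) * k x with hg
  have hfi : IntegrableOn f (Ioi 0) := integrableOn_rpow_mul_cexp hl hs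
  -- The weight factors as e^{-st} = e^{-sτ} e^{-s(t-τ)}, so the weighted convolution is the
  -- convolution of the two weighted functions and its integral is a product.
  have hmul : ∀ t : ℝ, Complex.exp (-s * t) *
      ∫ τ : ℝ in (0)..t, k (t - τ) * (((τ ^ (lam - 1) : ℝ) : ℂ) * Complex.exp (z * τ)) =
      ∫ τ in (0)..t, (ContinuousLinearMap.mul ℝ ℂ (f τ)) (g (t - τ)) := by
    intro t
    rw [← intervalIntegral.integral_const_mul]
    refine intervalIntegral.integral_congr fun τ _ => ?_
    simp only [ContinuousLinearMap.mul_apply', hf, hg]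
    have : Complex.exp (-s * t) * Complex.exp (z * τ) =
        Complex.exp (-(s - z) * τ) * Complex.exp (-s * (t - τ : ℝ)) := by
      rw [← Complex.exp_add, ← Complex.exp_add]; congr 1; push_cast; ring
    linear_combination (k (t - τ) * ((τ ^ (lam - 1) : ℝ) : ℂ)) * this
  simp only [hmul]
  constructor
  · have h := (integrable_posConvolution hfi hk (ContinuousLinearMap.mul ℝ ℂ)).integrableOn
      (s := Ioi 0)
    refine h.congr_fun (fun t ht => ?_) measurableSet_Ioi
    simp only [posConvolution]
    rw [indicator_of_mem ht]
  · rw [integral_posConvolution hfi hk (ContinuousLinearMap.mul ℝ ℂ), ContinuousLinearMap.mul_apply',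
      mul_comm, hf, integral_rpow_mul_cexp hl hs]

end Convolution

/-- Through this identity the normalisation K! · `risingCoeff` in `waveCoeff` becomes Γ(lam +
K)/Γ(lam), the denominator that convolution with t^{lam-1} produces. -/
theorem risingCoeff_eq_Gamma {lam : ℝ} (hl : 0 < lam) (n : ℕ) :
    Complex.Gamma lam * risingCoeff lam n = Complex.Gamma (lam + n) / n.factorial := by
  induction n with
  | zero => simp [risingCoeff]
  | succ n ih =>
    have h1 : (lam + n : ℂ) ≠ 0 := by
      intro h
      have := congrArg Complex.re h
      simp at this
      have hn : (0 : ℝ) ≤ n := n.cast_nonneg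
      linarith
    have h2 : (n.factorial : ℂ) ≠ 0 := by exact_mod_cast n.factorial_ne_zero
    have h3 : (n + 1 : ℂ) ≠ 0 := Nat.cast_add_one_ne_zero n
    rw [risingCoeff, mul_left_comm, ih, Nat.factorial_succ]
    push_cast
    rw [← add_assoc, Complex.Gamma_add_one _ h1]
    field_simp

/-- The convolution of the circle average of `(i r cos θ)^δ e^{i r x cos θ}` with
`t^{lam-1} e^{-i w t}`. -/
noncomputable def waveConvolution (lam r : ℝ) (δ : ℕ) (w t : ℝ) : ℂ :=
  ∫ τ : ℝ in (0)..t,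
    cosKernel r δ (t - τ) * (((τ ^ (lam - 1) : ℝ) : ℂ) * Complex.exp (-Complex.I * w * τ))

theorem hasSum_waveConvolution {lam : ℝ} (hl : 0 < lam) (r : ℝ) (δ : ℕ) (w : ℝ) {t : ℝ}
    (ht : 0 < t) :
    HasSum (fun K : ℕ => ((t ^ (lam - 1) : ℝ) : ℂ) *
        ((t : ℂ) ^ (K + 1) / ((K + 1).factorial * risingCoeff lam (K + 1))) *
        ∑ p ∈ Finset.HasAntidiagonal.antidiagonal K,
          cosMoment r (p.1 + δ) * ((-Complex.I * w) ^ p.2 * risingCoeff lam p.2))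
      (waveConvolution lam r δ w t) := by
  have h := hasSum_convolution hl (κ := fun n => cosMoment r (n + δ)) (c := |r| ^ δ) (M := |r|)
    (abs_nonneg r) (fun n => by rw [← pow_add, add_comm]; exact norm_cosMoment_le r _)
    (fun x => hasSum_cosKernel r δ x) (-Complex.I * w) ht
  refine h.congr_fun fun K => ?_
  have hG : Complex.Gamma lam ≠ 0 := Complex.Gamma_ne_zero_of_re_pos (by simpa using hl)
  have hK : ((K + 1).factorial : ℂ) ≠ 0 := by exact_mod_cast (K + 1).factorial_ne_zero
  have h1 : Complex.Gamma (lam + (K + 1 : ℕ)) =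
      Complex.Gamma lam * ((K + 1).factorial * risingCoeff lam (K + 1)) := by
    have := risingCoeff_eq_Gamma hl (K + 1)
    field_simp at this
    linear_combination -this
  simp only [← risingCoeff_eq_Gamma hl]
  rw [h1]
  have h2 : ∑ p ∈ Finset.HasAntidiagonal.antidiagonal K, cosMoment r (p.1 + δ) *
      ((-Complex.I * w) ^ p.2 * (Complex.Gamma lam * risingCoeff lam p.2)) =
      Complex.Gamma lam * ∑ p ∈ Finset.HasAntidiagonal.antidiagonal K, cosMoment r (p.1 + δ) *
      ((-Complex.I * w) ^ p.2 * risingCoeff lam p.2) := by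
    rw [Finset.mul_sum]
    exact Finset.sum_congr rfl fun p _ => by ring
  rw [h2]
  generalize (K + 1).factorial * risingCoeff lam (K + 1) = R
  field_simp

theorem integral_cosKernel_zero {r : ℝ} {s S : ℂ} (hs : 0 < s.re) (hS : 0 < S.re)
    (hsq : S ^ 2 = s ^ 2 + (r : ℂ) ^ 2) :
    ∫ x : ℝ in Ioi 0, Complex.exp (-s * x) * cosKernel r 0 x = S⁻¹ := by
  have hpi : ((2 * Real.pi : ℝ) : ℂ) ≠ 0 := by
    exact_mod_cast (by positivity : (2 * Real.pi : ℝ) ≠ 0)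
  rw [(laplace_cosKernel r 0 hs).2]
  simp only [pow_zero, one_div]
  rw [circle_average_inv_sub_cos hs hS hsq, inv_mul_cancel_left₀ hpi]

theorem sub_I_mul_cos_ne_zero {s : ℂ} (hs : 0 < s.re) (r θ : ℝ) :
    s - Complex.I * r * Real.cos θ ≠ 0 := by
  intro h
  have := congrArg Complex.re h
  simp [Complex.mul_re, Complex.mul_im] at this
  linarith

/-- With a = ir cos θ, a/(s - a) = s/(s - a) - 1. This is the transform rule for a derivative, with
J₀(0) = 1. -/
theorem integral_cosKernel_one {r : ℝ} {s S : ℂ} (hs : 0 < s.re) (hS : 0 < S.re)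
    (hsq : S ^ 2 = s ^ 2 + (r : ℂ) ^ 2) :
    ∫ x : ℝ in Ioi 0, Complex.exp (-s * x) * cosKernel r 1 x = s * S⁻¹ - 1 := by
  have hpi : ((2 * Real.pi : ℝ) : ℂ) ≠ 0 := by
    exact_mod_cast (by positivity : (2 * Real.pi : ℝ) ≠ 0)
  have h : ∀ θ : ℝ, (Complex.I * r * Real.cos θ) ^ 1 / (s - Complex.I * r * Real.cos θ) =
      s * (s - Complex.I * r * Real.cos θ)⁻¹ - 1 := by
    intro θ
    have := sub_I_mul_cos_ne_zero hs r θ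
    field_simp
    ring
  have hc : Continuous fun θ : ℝ => s * (s - Complex.I * r * Real.cos θ)⁻¹ :=
    continuous_const.mul (Continuous.inv₀ (by fun_prop) (sub_I_mul_cos_ne_zero hs r))
  rw [(laplace_cosKernel r 1 hs).2]
  simp only [h]
  rw [intervalIntegral.integral_sub (hc.intervalIntegrable _ _) intervalIntegrable_const,
    intervalIntegral.integral_const_mul, circle_average_inv_sub_cos hs hS hsq,
    intervalIntegral.integral_const, sub_zero, Complex.real_smul]
  field_simp

theorem laplace_waveConvolution {lam : ℝ} (hl : 0 < lam) (r : ℝ) (δ : ℕ) (w : ℝ) {s : ℂ}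
    (hs : 0 < s.re) :
    IntegrableOn (fun t : ℝ => Complex.exp (-s * t) * waveConvolution lam r δ w t) (Ioi 0) ∧
      ∫ t : ℝ in Ioi 0, Complex.exp (-s * t) * waveConvolution lam r δ w t =
        (∫ x : ℝ in Ioi 0, Complex.exp (-s * x) * cosKernel r δ x) *
          (Complex.Gamma lam * ((s + Complex.I * w) ^ (lam : ℂ))⁻¹) := by
  have h := laplace_convolution hl (k := cosKernel r δ) (s := s) (z := -Complex.I * w)
    (by simpa using hs) (laplace_cosKernel r δ hs).1
  rw [show s - -Complex.I * w = s + Complex.I * w by ring] at h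
  exact h

end PlaneWaveSpectrum

namespace PlaneWaveSpectrum

open ComplexClifford MeasureTheory Set

variable {m : ℕ}

/-! ### Phases, and summation of the kernel in closed form -/

section Phases

theorem parityPhase_zero : parityPhase 0 = 1 := by simp [parityPhase]

theorem parityPhase_one : parityPhase 1 = Complex.I := by
  rw [parityPhase, Int.cast_one, one_pow, mul_one, mul_comm, Complex.exp_pi_div_two_mul_I]

/-- A function of the parity of K is a combination of 1 and (-1)^K, and the sign (-1)^K amounts to
replacing t by -t in the degree K term. This is the origin of the two waves ε = ±1 and of the
factors 1 ± i. -/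
theorem parityPhase_natCast_add (K : ℕ) (n : ℤ) :
    parityPhase (K + n) = (parityPhase n + parityPhase (n + 1)) / 2 +
      (-1) ^ K * ((parityPhase n - parityPhase (n + 1)) / 2) := by
  rcases Nat.even_or_odd K with h | h
  · rw [h.neg_one_pow, parityPhase_eq_of_even (ε := n)]
    · ring
    · obtain ⟨i, hi⟩ := h
      exact ⟨i, by omega⟩
  · rw [h.neg_one_pow, parityPhase_eq_of_even (ε := n + 1)]
    · ring
    · obtain ⟨i, hi⟩ := h
      exact ⟨i, by omega⟩

end Phases

section Series

/-- Only even n contribute, and (-iε)² = i². Thus the Bessel factor is the same for both signs ε. -/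
theorem evenCoeff_mul_pow (μ : ℂ) {ε : ℂ} (hε : ε ^ 2 = 1) (n : ℕ) :
    evenCoeff μ n * (-Complex.I * ε) ^ n = evenCoeff μ n * Complex.I ^ n := by
  rcases Nat.even_or_odd n with h | h
  · obtain ⟨i, rfl⟩ := h
    have h1 : (-Complex.I * ε) ^ (i + i) = Complex.I ^ (i + i) := by
      rw [← two_mul, pow_mul, pow_mul, mul_pow, hε, mul_one, neg_sq]
    rw [h1]
  · rw [evenCoeff_of_odd μ h, zero_mul, zero_mul]

theorem coeff_succ_bivectorPartSeries (l w r : ℂ) (K : ℕ) :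
    PowerSeries.coeff (K + 1) (bivectorPartSeries l w r) =
      1 / 2 * ∑ p ∈ Finset.HasAntidiagonal.antidiagonal K,
        evenCoeff (1 / 2) p.1 * r ^ p.1 * (risingCoeff l p.2 * w ^ p.2) := by
  have h : bivectorPartSeries l w r =
      PowerSeries.C (1 / 2) * (PowerSeries.X * (evenSeries (1 / 2) r * risingSeries l w)) := by
    rw [bivectorPartSeries]; ring
  rw [h, PowerSeries.coeff_C_mul, PowerSeries.coeff_succ_X_mul, PowerSeries.coeff_mul]
  simp only [evenSeries, risingSeries, PowerSeries.coeff_mk]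

/-- The series 1 - (1 - r²u²)^{-1/2} has no constant term. The resulting index shift p.1 + 1 picks
out the moments of the derivative of J₀, whereas the bivector part involves J₀ itself. -/
theorem coeff_succ_risingSeries_sub (l w r : ℂ) (K : ℕ) :
    PowerSeries.coeff (K + 1) (risingSeries l w - scalarPartSeries l w r) =
      -(1 / 2) * ∑ p ∈ Finset.HasAntidiagonal.antidiagonal K,
        evenCoeff (1 / 2) (p.1 + 1) * r ^ (p.1 + 1) * (risingCoeff l p.2 * w ^ p.2) := by
  have h2 : (PowerSeries.C (1 / 2 : ℂ) : PowerSeries ℂ) * 2 = 1 := by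
    rw [← map_ofNat PowerSeries.C, ← map_mul]; norm_num
  have h : risingSeries l w - scalarPartSeries l w r =
      PowerSeries.C (1 / 2) * ((1 - evenSeries (1 / 2) r) * risingSeries l w) := by
    rw [scalarPartSeries]
    linear_combination -(risingSeries l w) * h2
  rw [h, PowerSeries.coeff_C_mul, PowerSeries.coeff_mul, Finset.Nat.sum_antidiagonal_succ]
  have h0 : PowerSeries.coeff 0 (1 - evenSeries (1 / 2) r) = 0 := by
    simp [evenSeries, evenCoeff]
  have h1 : ∀ n, PowerSeries.coeff (n + 1) (1 - evenSeries (1 / 2) r) =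
      -(evenCoeff (1 / 2) (n + 1) * r ^ (n + 1)) := by
    intro n
    rw [map_sub, PowerSeries.coeff_one, if_neg (Nat.succ_ne_zero n), evenSeries,
      PowerSeries.coeff_mk, zero_sub]
  simp only [h0, h1, zero_mul, zero_add, neg_mul, Finset.sum_neg_distrib, risingSeries,
    PowerSeries.coeff_mk]
  ring

variable {t ε : ℝ} (x y : EuclideanSpace ℝ (Fin m))

theorem half_natCast (m : ℕ) : (((m : ℝ) / 2 : ℝ) : ℂ) = (m : ℂ) / 2 := by push_cast; rfl

theorem half_pos_of_one_le (hm : 1 ≤ m) : (0 : ℝ) < (m : ℝ) / 2 := by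
  have : (1 : ℝ) ≤ m := by exact_mod_cast hm
  linarith

theorem hasSum_bivectorPart (hm : 1 ≤ m) (ht : 0 < t) (hε : ε ^ 2 = 1) :
    HasSum (fun K : ℕ => ((t ^ ((m : ℝ) / 2 - 1) : ℝ) : ℂ) * ((ε : ℂ) ^ K * waveCoeff m t K) *
        PowerSeries.coeff K (bivectorPartSeries (m / 2) (innerC x y) ((‖x‖ : ℂ) * ‖y‖)))
      (-(Complex.I * ε / 2) *
        waveConvolution ((m : ℝ) / 2) (‖x‖ * ‖y‖) 0 (ε * inner ℝ x y) t) := by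
  have hε' : (ε : ℂ) ^ 2 = 1 := by exact_mod_cast hε
  have h := (hasSum_waveConvolution (half_pos_of_one_le hm) (‖x‖ * ‖y‖) 0
    (ε * inner ℝ x y) ht).mul_left (-(Complex.I * ε / 2))
  -- Convolution raises the degree by one, so its degree K term is matched with degree K + 1 here;
  -- the degree 0 term of the series vanishes.
  rw [← hasSum_nat_add_iff' 1]
  simp only [Finset.range_one, Finset.sum_singleton]
  have h0 : PowerSeries.coeff 0
      (bivectorPartSeries (m / 2) (innerC x y) ((‖x‖ : ℂ) * ‖y‖)) = 0 := by
    simp [bivectorPartSeries]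
  rw [h0, mul_zero, sub_zero]
  refine h.congr_fun fun K => ?_
  rw [coeff_succ_bivectorPartSeries, half_natCast, waveCoeff]
  have hterm : ∀ p ∈ Finset.HasAntidiagonal.antidiagonal K,
      cosMoment (‖x‖ * ‖y‖) (p.1 + 0) *
        ((-Complex.I * ((ε * inner ℝ x y : ℝ) : ℂ)) ^ p.2 * risingCoeff (m / 2) p.2) =
      (-Complex.I * ε) ^ K * (evenCoeff (1 / 2) p.1 * ((‖x‖ : ℂ) * ‖y‖) ^ p.1 *
        (risingCoeff (m / 2) p.2 * innerC x y ^ p.2)) := by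
    intro p hp
    rw [Finset.HasAntidiagonal.mem_antidiagonal] at hp
    have he := evenCoeff_mul_pow (1 / 2) hε' p.1
    rw [cosMoment_eq, ← hp, innerC, add_zero, pow_add]
    push_cast
    rw [show -Complex.I * (ε * ((inner ℝ x y : ℝ) : ℂ)) =
      (-Complex.I * ε) * ((inner ℝ x y : ℝ) : ℂ) by ring, mul_pow (-Complex.I * (ε : ℂ))]
    linear_combination -((-Complex.I * (ε : ℂ)) ^ p.2 * ((inner ℝ x y : ℝ) : ℂ) ^ p.2 *
      risingCoeff (m / 2) p.2 * ((‖x‖ : ℂ) * ‖y‖) ^ p.1) * he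
  rw [Finset.sum_congr rfl hterm, ← Finset.mul_sum]
  generalize (((K + 1).factorial : ℂ) * risingCoeff (m / 2) (K + 1)) = R
  have hpow : (ε : ℂ) ^ (K + 1) * (-Complex.I * t) ^ (K + 1) =
      (-Complex.I * ε) * (-Complex.I * ε) ^ K * (t : ℂ) ^ (K + 1) := by
    rw [← mul_pow, ← pow_succ', ← mul_pow]; congr 1; ring
  generalize (∑ p ∈ Finset.HasAntidiagonal.antidiagonal K, evenCoeff (1 / 2) p.1 *
    ((‖x‖ : ℂ) * ‖y‖) ^ p.1 * (risingCoeff (m / 2) p.2 * innerC x y ^ p.2)) = Q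
  linear_combination (((t ^ ((m : ℝ) / 2 - 1) : ℝ) : ℂ) * R⁻¹ * (1 / 2) * Q) * hpow

theorem hasSum_scalarPart (hm : 1 ≤ m) (ht : 0 < t) (hε : ε ^ 2 = 1) :
    HasSum (fun K : ℕ => ((t ^ ((m : ℝ) / 2 - 1) : ℝ) : ℂ) * ((ε : ℂ) ^ K * waveCoeff m t K) *
        PowerSeries.coeff K (risingSeries (m / 2) (innerC x y) -
          scalarPartSeries (m / 2) (innerC x y) ((‖x‖ : ℂ) * ‖y‖)))
      (-(1 / 2) * waveConvolution ((m : ℝ) / 2) (‖x‖ * ‖y‖) 1 (ε * inner ℝ x y) t) := by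
  have hε' : (ε : ℂ) ^ 2 = 1 := by exact_mod_cast hε
  have h := (hasSum_waveConvolution (half_pos_of_one_le hm) (‖x‖ * ‖y‖) 1
    (ε * inner ℝ x y) ht).mul_left (-(1 / 2))
  rw [← hasSum_nat_add_iff' 1]
  simp only [Finset.range_one, Finset.sum_singleton]
  have h0 : PowerSeries.coeff 0 (risingSeries (m / 2) (innerC x y) -
      scalarPartSeries (m / 2) (innerC x y) ((‖x‖ : ℂ) * ‖y‖)) = 0 := by
    simp [risingSeries, scalarPartSeries, evenSeries, risingCoeff, evenCoeff]
    norm_num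
  rw [h0, mul_zero, sub_zero]
  refine h.congr_fun fun K => ?_
  rw [coeff_succ_risingSeries_sub, half_natCast, waveCoeff]
  have hterm : ∀ p ∈ Finset.HasAntidiagonal.antidiagonal K,
      cosMoment (‖x‖ * ‖y‖) (p.1 + 1) *
        ((-Complex.I * ((ε * inner ℝ x y : ℝ) : ℂ)) ^ p.2 * risingCoeff (m / 2) p.2) =
      (-Complex.I * ε) ^ (K + 1) * (evenCoeff (1 / 2) (p.1 + 1) * ((‖x‖ : ℂ) * ‖y‖) ^ (p.1 + 1) *
        (risingCoeff (m / 2) p.2 * innerC x y ^ p.2)) := by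
    intro p hp
    rw [Finset.HasAntidiagonal.mem_antidiagonal] at hp
    have he := evenCoeff_mul_pow (1 / 2) hε' (p.1 + 1)
    rw [cosMoment_eq, ← hp, innerC, show p.1 + p.2 + 1 = (p.1 + 1) + p.2 by ring,
      pow_add (-Complex.I * (ε : ℂ))]
    push_cast
    rw [show -Complex.I * (ε * ((inner ℝ x y : ℝ) : ℂ)) =
      (-Complex.I * ε) * ((inner ℝ x y : ℝ) : ℂ) by ring, mul_pow (-Complex.I * (ε : ℂ)) _ p.2]
    linear_combination -((-Complex.I * (ε : ℂ)) ^ p.2 * ((inner ℝ x y : ℝ) : ℂ) ^ p.2 *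
      risingCoeff (m / 2) p.2 * ((‖x‖ : ℂ) * ‖y‖) ^ (p.1 + 1)) * he
  rw [Finset.sum_congr rfl hterm, ← Finset.mul_sum]
  generalize (((K + 1).factorial : ℂ) * risingCoeff (m / 2) (K + 1)) = R
  have hpow : (ε : ℂ) ^ (K + 1) * (-Complex.I * t) ^ (K + 1) =
      (-Complex.I * ε) ^ (K + 1) * (t : ℂ) ^ (K + 1) := by
    rw [← mul_pow, ← mul_pow]; congr 1; ring
  generalize (∑ p ∈ Finset.HasAntidiagonal.antidiagonal K, evenCoeff (1 / 2) (p.1 + 1) *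
    ((‖x‖ : ℂ) * ‖y‖) ^ (p.1 + 1) * (risingCoeff (m / 2) p.2 * innerC x y ^ p.2)) = Q
  linear_combination (-((t ^ ((m : ℝ) / 2 - 1) : ℝ) : ℂ) * R⁻¹ * (1 / 2) * Q) * hpow

/-- The value of `t^{m/2-1} e^{-itε(x,y)}`. -/
noncomputable def waveSum (x y : EuclideanSpace ℝ (Fin m)) (ε t : ℝ) : ℂ :=
  ((t ^ ((m : ℝ) / 2 - 1) : ℝ) : ℂ) * Complex.exp (-(Complex.I * (ε * inner ℝ x y : ℝ)) * t)

/-- The sum of the series of the components `minusPart`, with the sign `ε^K` in degree `K`. -/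
noncomputable def minusSum (x y : EuclideanSpace ℝ (Fin m)) (ε t : ℝ) : ComplexClifford m :=
  (-(1 / 2) * waveConvolution ((m : ℝ) / 2) (‖x‖ * ‖y‖) 1 (ε * inner ℝ x y) t) • 1 +
    ((Complex.I * ε / 2) *
      waveConvolution ((m : ℝ) / 2) (‖x‖ * ‖y‖) 0 (ε * inner ℝ x y) t) • (vec y * vec x)

theorem hasSum_minusPart (hm : 1 ≤ m) (ht : 0 < t) (hε : ε ^ 2 = 1) :
    HasSum (fun K : ℕ => (((t ^ ((m : ℝ) / 2 - 1) : ℝ) : ℂ) * ((ε : ℂ) ^ K * waveCoeff m t K)) •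
      minusPart x K y) (minusSum x y ε t) := by
  have h1 := (hasSum_scalarPart x y hm ht hε).smul_const (1 : ComplexClifford m)
  have h2 := ((hasSum_bivectorPart x y hm ht hε).neg).smul_const (vec y * vec x)
  rw [← neg_mul, neg_neg] at h2
  refine (h1.add h2).congr_fun fun K => ?_
  rw [minusPart, zonal]
  module

theorem hasSum_wave (hm : 1 ≤ m) :
    HasSum (fun K : ℕ => (((t ^ ((m : ℝ) / 2 - 1) : ℝ) : ℂ) * ((ε : ℂ) ^ K * waveCoeff m t K)) *
      (risingCoeff (m / 2) K * innerC x y ^ K)) (waveSum x y ε t) := by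
  have he : HasSum (fun n : ℕ => (-(Complex.I * (ε * inner ℝ x y : ℝ)) * (t : ℂ)) ^ n / n.factorial)
      (Complex.exp (-(Complex.I * (ε * inner ℝ x y : ℝ)) * t)) := by
    rw [Complex.exp_eq_exp_ℂ]
    exact NormedSpace.expSeries_div_hasSum_exp _
  refine (he.mul_left ((t ^ ((m : ℝ) / 2 - 1) : ℝ) : ℂ)).congr_fun fun K => ?_
  have h1 := risingCoeff_ne_zero hm K
  have h2 : (K.factorial : ℂ) ≠ 0 := by exact_mod_cast K.factorial_ne_zero
  have h3 : (-(Complex.I * (ε * inner ℝ x y : ℝ)) * (t : ℂ)) ^ K =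
      (ε : ℂ) ^ K * (-Complex.I * t) ^ K * innerC x y ^ K := by
    rw [← mul_pow, ← mul_pow, innerC]; congr 1; push_cast; ring
  rw [waveCoeff, h3]
  field_simp

/-- The two components add up to the plane wave, whose series is exponential, so this sum is the
wave minus the other sum. -/
theorem hasSum_plusPart (hm : 1 ≤ m) (ht : 0 < t) (hε : ε ^ 2 = 1) :
    HasSum (fun K : ℕ => (((t ^ ((m : ℝ) / 2 - 1) : ℝ) : ℂ) * ((ε : ℂ) ^ K * waveCoeff m t K)) •
      plusPart x K y) (waveSum x y ε t • 1 - minusSum x y ε t) := by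
  refine (((hasSum_wave x y hm).smul_const (1 : ComplexClifford m)).sub
    (hasSum_minusPart x y hm ht hε)).congr_fun fun K => ?_
  rw [mul_smul _ (risingCoeff (m / 2) K * innerC x y ^ K), ← plusPart_add_minusPart, smul_add,
    add_sub_cancel_right]

/-- The coefficient of the even-degree part in `e^{iπΓ²/2}` on `minusPart`. -/
noncomputable def minusPhase (m : ℕ) (ε : ℝ) : ℂ := (parityPhase m + ε * parityPhase (m + 1)) / 2

theorem hasSum_kernel (hm : 1 ≤ m) (ht : 0 < t) :
    HasSum (fun K : ℕ => ((t ^ ((m : ℝ) / 2 - 1) : ℝ) : ℂ) • (waveCoeff m t K •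
        (parityPhase K • plusPart x K y + parityPhase (K + m) • minusPart x K y)))
      (((1 + Complex.I) / 2) • (waveSum x y 1 t • (1 : ComplexClifford m) - minusSum x y 1 t) +
        ((1 - Complex.I) / 2) • (waveSum x y (-1) t • (1 : ComplexClifford m) - minusSum x y (-1) t) +
        minusPhase m 1 • minusSum x y 1 t + minusPhase m (-1) • minusSum x y (-1) t) := by
  have h1 := (hasSum_plusPart (ε := 1) x y hm ht (by norm_num)).const_smul ((1 + Complex.I) / 2)
  have h2 := (hasSum_plusPart (ε := -1) x y hm ht (by norm_num)).const_smul ((1 - Complex.I) / 2)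
  have h3 := (hasSum_minusPart (ε := 1) x y hm ht (by norm_num)).const_smul (minusPhase m 1)
  have h4 := (hasSum_minusPart (ε := -1) x y hm ht (by norm_num)).const_smul (minusPhase m (-1))
  refine (((h1.add h2).add h3).add h4).congr_fun fun K => ?_
  have h5 := parityPhase_natCast_add K 0
  rw [parityPhase_zero, zero_add, parityPhase_one, add_zero] at h5
  rw [h5, parityPhase_natCast_add K m, minusPhase, minusPhase]
  push_cast
  simp only [one_pow]
  module

theorem operatorExp_eq (hm : 1 ≤ m) (t : ℝ) :
    operatorExp gammaSqExponent (planeWave x t) y = ∑' K : ℕ, waveCoeff m t K •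
        (parityPhase K • plusPart x K y + parityPhase (K + m) • minusPart x K y) := by
  rw [operatorExp]
  exact tsum_congr fun K => (expTerm_homogeneousPart hm x y t K).2

theorem gammaSqKernel_eq (hm : 1 ≤ m) (ht : 0 < t) :
    gammaSqKernel x y t =
      ((1 + Complex.I) / 2) • (waveSum x y 1 t • (1 : ComplexClifford m) - minusSum x y 1 t) +
        ((1 - Complex.I) / 2) • (waveSum x y (-1) t • (1 : ComplexClifford m) - minusSum x y (-1) t) +
        minusPhase m 1 • minusSum x y 1 t + minusPhase m (-1) • minusSum x y (-1) t := by
  rw [gammaSqKernel, operatorExp_eq x y hm, ← tsum_const_smul'']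
  exact (hasSum_kernel x y hm ht).tsum_eq

theorem norm_waveCoeff_le {t T : ℝ} (h : |t| ≤ T) (K : ℕ) :
    ‖waveCoeff m t K‖ ≤ ‖waveCoeff m T K‖ := by
  have hT : |t| ≤ |T| := h.trans (le_abs_self T)
  simp only [waveCoeff, norm_div, norm_pow, norm_mul, norm_neg, Complex.norm_I, one_mul,
    Complex.norm_real, Real.norm_eq_abs]
  gcongr

theorem operatorExpConverges (hm : 1 ≤ m) (t : ℝ) :
    OperatorExpConverges gammaSqExponent (planeWave x t) y := by
  refine ⟨fun K => (expTerm_homogeneousPart hm x y t K).1, ?_⟩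
  -- The summed expansion is available only for positive times. Only `waveCoeff` depends on time,
  -- and its norm increases with |t|, so summability at |t| + 1 dominates every real t, including t
  -- ≤ 0. Finite dimension then turns summability into absolute summability.
  have hT : 0 < |t| + 1 := by positivity
  have hc : (((|t| + 1) ^ ((m : ℝ) / 2 - 1) : ℝ) : ℂ) ≠ 0 :=
    Complex.ofReal_ne_zero.mpr (Real.rpow_pos_of_pos hT _).ne'
  have h := ((hasSum_kernel x y hm hT).summable.const_smul
    (((|t| + 1) ^ ((m : ℝ) / 2 - 1) : ℝ) : ℂ)⁻¹)
  simp only [inv_smul_smul₀ hc] at h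
  have : FiniteDimensional ℝ (ComplexClifford m) := FiniteDimensional.complexToReal _
  refine Summable.of_nonneg_of_le (fun _ => norm_nonneg _) (fun K => ?_) (summable_norm_iff.mpr h)
  rw [(expTerm_homogeneousPart hm x y t K).2, norm_smul, norm_smul]
  exact mul_le_mul_of_nonneg_right (norm_waveCoeff_le (by linarith) K) (norm_nonneg _)

end Series

end PlaneWaveSpectrum

namespace PlaneWaveSpectrum

open ComplexClifford MeasureTheory Set

variable {m : ℕ}

/-! ### Laplace transform of the kernel and comparison with the closed formula -/

section Laplace

variable (x y : EuclideanSpace ℝ (Fin m)) {s : ℂ}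

theorem sqrtPlus_sq : sqrtPlus x y s ^ 2 = s ^ 2 + ((‖x‖ * ‖y‖ : ℝ) : ℂ) ^ 2 := by
  rw [sqrtPlus, one_div, ← Nat.cast_two (R := ℂ), Complex.cpow_nat_inv_pow _ two_ne_zero]
  push_cast
  ring

/-- If s is real the value is positive; otherwise its imaginary part 2 Re s · Im s is nonzero. The
principal square root thus has positive real part, which is the branch required by the circle
average. -/
theorem add_sq_mem_slitPlane (hs : 0 < s.re) (r : ℝ) :
    s ^ 2 + (r : ℂ) ^ 2 ∈ Complex.slitPlane := by
  have him : (s ^ 2 + (r : ℂ) ^ 2).im = 2 * s.re * s.im := by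
    simp [pow_two]; ring
  have hre : (s ^ 2 + (r : ℂ) ^ 2).re = s.re ^ 2 - s.im ^ 2 + r ^ 2 := by
    simp [pow_two]
  rw [Complex.mem_slitPlane_iff, him, hre]
  by_cases h : s.im = 0
  · left
    rw [h]
    nlinarith [sq_nonneg r]
  · exact Or.inr (mul_ne_zero (by positivity) h)

theorem sqrtPlus_re_pos (hs : 0 < s.re) : 0 < (sqrtPlus x y s).re := by
  have hz := add_sq_mem_slitPlane hs (‖x‖ * ‖y‖)
  have he : sqrtPlus x y s = (s ^ 2 + ((‖x‖ * ‖y‖ : ℝ) : ℂ) ^ 2) ^ (((1 / 2 : ℝ)) : ℂ) := by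
    rw [sqrtPlus]
    push_cast
    rw [mul_pow]
  rw [he, Complex.cpow_ofReal_re]
  have h1 := Complex.neg_pi_lt_arg (s ^ 2 + ((‖x‖ * ‖y‖ : ℝ) : ℂ) ^ 2)
  have h2 := (Complex.arg_le_pi (s ^ 2 + ((‖x‖ * ‖y‖ : ℝ) : ℂ) ^ 2)).lt_of_ne
    (Complex.mem_slitPlane_iff_arg.mp hz).1
  exact mul_pos (Real.rpow_pos_of_pos (norm_pos_iff.mpr (Complex.slitPlane_ne_zero hz)) _)
    (Real.cos_pos_of_mem_Ioo ⟨by linarith, by linarith⟩)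

/-- The Laplace transform of `t^{m/2-1} e^{-itε(x,y)}`. -/
noncomputable def waveTransform (x y : EuclideanSpace ℝ (Fin m)) (ε : ℝ) (s : ℂ) : ℂ :=
  Complex.Gamma ((m : ℂ) / 2) * ((s + Complex.I * (ε * innerC x y)) ^ ((m : ℂ) / 2))⁻¹

theorem hasLaplace_waveSum (hm : 1 ≤ m) (hs : 0 < s.re) (ε : ℝ) :
    IntegrableOn (fun t : ℝ => Complex.exp (-s * t) * waveSum x y ε t) (Ioi 0) ∧
      ∫ t in Ioi (0 : ℝ), Complex.exp (-s * t) * waveSum x y ε t = waveTransform x y ε s := by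
  have hz : 0 < (s + Complex.I * (ε * innerC x y)).re := by
    rw [innerC, ← Complex.ofReal_mul]; simpa using hs
  have he : (fun t : ℝ => Complex.exp (-s * t) * waveSum x y ε t) = fun t : ℝ =>
      ((t ^ ((m : ℝ) / 2 - 1) : ℝ) : ℂ) *
        Complex.exp (-(s + Complex.I * (ε * innerC x y)) * t) := by
    funext t
    rw [waveSum, mul_left_comm, ← Complex.exp_add, innerC]
    congr 2
    push_cast
    ring
  rw [he]
  refine ⟨integrableOn_rpow_mul_cexp (half_pos_of_one_le hm) hz, ?_⟩
  rw [integral_rpow_mul_cexp (half_pos_of_one_le hm) hz, half_natCast, waveTransform]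

theorem hasLaplace_minusSum (hm : 1 ≤ m) (hs : 0 < s.re) (ε : ℝ) :
    IntegrableOn (fun t : ℝ => Complex.exp (-s * t) • minusSum x y ε t) (Ioi 0) ∧
      ∫ t in Ioi (0 : ℝ), Complex.exp (-s * t) • minusSum x y ε t =
        (-(1 / 2) * (s * (sqrtPlus x y s)⁻¹ - 1) * waveTransform x y ε s) • 1 +
          (Complex.I * ε / 2 * (sqrtPlus x y s)⁻¹ * waveTransform x y ε s) • (vec y * vec x) := by
  have hS := sqrtPlus_re_pos x y hs
  have hsq := sqrtPlus_sq x y (s := s)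
  obtain ⟨i1, e1⟩ := laplace_waveConvolution (half_pos_of_one_le hm) (‖x‖ * ‖y‖) 1
    (ε * inner ℝ x y) hs
  obtain ⟨i0, e0⟩ := laplace_waveConvolution (half_pos_of_one_le hm) (‖x‖ * ‖y‖) 0
    (ε * inner ℝ x y) hs
  rw [integral_cosKernel_one hs hS hsq] at e1
  rw [integral_cosKernel_zero hs hS hsq] at e0
  have he : (fun t : ℝ => Complex.exp (-s * t) • minusSum x y ε t) = fun t : ℝ =>
      (-(1 / 2) * (Complex.exp (-s * t) *
        waveConvolution ((m : ℝ) / 2) (‖x‖ * ‖y‖) 1 (ε * inner ℝ x y) t)) •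
          (1 : ComplexClifford m) +
      (Complex.I * ε / 2 * (Complex.exp (-s * t) *
        waveConvolution ((m : ℝ) / 2) (‖x‖ * ‖y‖) 0 (ε * inner ℝ x y) t)) •
          (vec y * vec x) := by
    funext t
    rw [minusSum]
    module
  have j1 := (i1.const_mul (-(1 / 2) : ℂ)).smul_const (1 : ComplexClifford m)
  have j0 := (i0.const_mul (Complex.I * ε / 2)).smul_const (vec y * vec x)
  rw [he]
  refine ⟨j1.add j0, ?_⟩
  rw [integral_add j1 j0, integral_smul_const, integral_smul_const, integral_const_mul,
    integral_const_mul, e1, e0, half_natCast, waveTransform, innerC]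
  push_cast
  module

theorem hasLaplace_gammaSqKernel (hm : 1 ≤ m) (hs : 0 < s.re) :
    IntegrableOn (laplaceIntegrand (gammaSqKernel x y) s) (Ioi 0) ∧
      laplace (gammaSqKernel x y) s =
        ((1 + Complex.I) / 2) • waveTransform x y 1 s • (1 : ComplexClifford m) +
        ((1 - Complex.I) / 2) • waveTransform x y (-1) s • (1 : ComplexClifford m) +
        (minusPhase m 1 - (1 + Complex.I) / 2) •
          ((-(1 / 2) * (s * (sqrtPlus x y s)⁻¹ - 1) * waveTransform x y 1 s) • 1 +
            (Complex.I / 2 * (sqrtPlus x y s)⁻¹ * waveTransform x y 1 s) • (vec y * vec x)) +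
        (minusPhase m (-1) - (1 - Complex.I) / 2) •
          ((-(1 / 2) * (s * (sqrtPlus x y s)⁻¹ - 1) * waveTransform x y (-1) s) • 1 +
            (-Complex.I / 2 * (sqrtPlus x y s)⁻¹ * waveTransform x y (-1) s) •
              (vec y * vec x)) := by
  obtain ⟨i1, e1⟩ := hasLaplace_waveSum x y hm hs 1
  obtain ⟨i2, e2⟩ := hasLaplace_waveSum x y hm hs (-1)
  obtain ⟨i3, e3⟩ := hasLaplace_minusSum x y hm hs 1
  obtain ⟨i4, e4⟩ := hasLaplace_minusSum x y hm hs (-1)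
  have j1 := (i1.smul_const (1 : ComplexClifford m)).smul ((1 + Complex.I) / 2)
  have j2 := (i2.smul_const (1 : ComplexClifford m)).smul ((1 - Complex.I) / 2)
  have j3 := i3.smul (minusPhase m 1 - (1 + Complex.I) / 2)
  have j4 := i4.smul (minusPhase m (-1) - (1 - Complex.I) / 2)
  -- The first component is the wave minus `minusSum`, so `minusSum` carries the difference of the
  -- two phase coefficients.
  have he : EqOn (laplaceIntegrand (gammaSqKernel x y) s) (fun t : ℝ =>
      ((1 + Complex.I) / 2) • (Complex.exp (-s * t) * waveSum x y 1 t) • (1 : ComplexClifford m) +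
      ((1 - Complex.I) / 2) • (Complex.exp (-s * t) * waveSum x y (-1) t) •
        (1 : ComplexClifford m) +
      (minusPhase m 1 - (1 + Complex.I) / 2) • Complex.exp (-s * t) • minusSum x y 1 t +
      (minusPhase m (-1) - (1 - Complex.I) / 2) • Complex.exp (-s * t) • minusSum x y (-1) t)
      (Ioi 0) := by
    intro t ht
    simp only [laplaceIntegrand]
    rw [gammaSqKernel_eq x y hm ht]
    module
  have j := ((j1.add j2).add j3).add j4
  refine ⟨IntegrableOn.congr_fun j he.symm measurableSet_Ioi, ?_⟩
  rw [laplace, setIntegral_congr_fun measurableSet_Ioi he]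
  refine (integral_add ((j1.add j2).add j3) j4).trans ?_
  refine congrArg₂ (· + ·) ((integral_add (j1.add j2) j3).trans
    (congrArg₂ (· + ·) ((integral_add j1 j2).trans (congrArg₂ (· + ·) ?_ ?_)) ?_)) ?_
  · rw [← e1, ← integral_smul_const, ← integral_smul]; rfl
  · rw [← e2, ← integral_smul_const, ← integral_smul]; rfl
  · refine (integral_smul (minusPhase m 1 - (1 + Complex.I) / 2) fun t : ℝ =>
      Complex.exp (-s * t) • minusSum x y 1 t).trans (congrArg _ (e3.trans ?_))
    push_cast
    module
  · refine (integral_smul (minusPhase m (-1) - (1 - Complex.I) / 2) fun t : ℝ =>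
      Complex.exp (-s * t) • minusSum x y (-1) t).trans (congrArg _ (e4.trans ?_))
    push_cast
    module

theorem parityPhase_sub_one (m : ℕ) :
    Complex.exp (Complex.I * (Real.pi / 2) * ((m : ℂ) - 1) ^ 2) = parityPhase (m + 1) := by
  rw [parityPhase_eq_of_even (k := m + 1) (ε := m - 1) ⟨1, by ring⟩, parityPhase]
  push_cast
  rfl

/-- For odd m the phases at m and m + 1 are i and 1, so the coefficient of `minusSum` vanishes for ε
= 1 and equals i - 1 for ε = -1. Accordingly U¹ + U³ has numerator 2√₊, while U² + U⁴ has numerator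
2(s + i yx). -/
theorem laplace_eq_of_odd (h : Odd m) (hs : 0 < s.re) :
    laplace (gammaSqKernel x y) s =
      (Complex.Gamma ((m : ℂ) / 2) / (4 * sqrtPlus x y s)) •
        ((1 + Complex.I) • U₁ x y s + (1 - Complex.I) • U₂ x y s +
          Complex.exp (Complex.I * (Real.pi / 2) * ((m : ℂ) - 1) ^ 2) •
            ((1 + Complex.I) • U₃ x y s + (1 - Complex.I) • U₄ x y s)) := by
  obtain ⟨k, rfl⟩ := h
  have hS : sqrtPlus x y s ≠ 0 := fun h => by
    have := sqrtPlus_re_pos x y hs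
    simp [h] at this
  have h0 : parityPhase ((2 * k + 1 : ℕ) + 1) = 1 := by
    rw [← parityPhase_zero]; exact parityPhase_eq_of_even ⟨k + 1, by push_cast; ring⟩
  have h1 : parityPhase (2 * k + 1 : ℕ) = Complex.I := by
    rw [← parityPhase_one]; exact parityPhase_eq_of_even ⟨k, by push_cast; ring⟩
  have hsign : (-1 : ℂ) ^ (2 * k + 1 - 1) = 1 := by simp
  rw [(hasLaplace_gammaSqKernel x y (by omega) hs).2, parityPhase_sub_one, minusPhase, minusPhase,
    h0, h1, U₁, U₂, U₃, U₄, hsign, waveTransform, waveTransform]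
  simp only [Algebra.algebraMap_eq_smul_one, Complex.ofReal_one, Complex.ofReal_neg, one_mul,
    neg_mul, mul_neg, ← sub_eq_add_neg]
  match_scalars
  · field_simp
    ring
  · field_simp
    ring

/-- For even m both components have the parity of K, so the coefficients of `minusSum` vanish for
both signs and only the two waves remain. On the other side the sign (-1)^{m-1} = -1 exchanges
denominators: U⁴ combines with U¹ and U³ with U², each pair leaving 2√₊ in the numerator. -/
theorem laplace_eq_of_even (h : Even m) (hm : 1 ≤ m) (hs : 0 < s.re) :
    laplace (gammaSqKernel x y) s =
      (Complex.Gamma ((m : ℂ) / 2) / (4 * sqrtPlus x y s)) •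
        ((1 + Complex.I) • U₁ x y s + (1 - Complex.I) • U₂ x y s +
          Complex.exp (Complex.I * (Real.pi / 2) * ((m : ℂ) - 1) ^ 2) •
            ((1 + Complex.I) • U₃ x y s + (1 - Complex.I) • U₄ x y s)) := by
  have hS : sqrtPlus x y s ≠ 0 := fun h => by
    have := sqrtPlus_re_pos x y hs
    simp [h] at this
  have hsign : (-1 : ℂ) ^ (m - 1) = -1 := (Nat.Even.sub_odd hm h odd_one).neg_one_pow
  obtain ⟨k, hk⟩ := h
  have h0 : parityPhase m = 1 := by
    rw [← parityPhase_zero]; exact parityPhase_eq_of_even ⟨k, by omega⟩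
  have h1 : parityPhase (m + 1) = Complex.I := by
    rw [← parityPhase_one]; exact parityPhase_eq_of_even ⟨k, by omega⟩
  rw [(hasLaplace_gammaSqKernel x y hm hs).2, parityPhase_sub_one, minusPhase, minusPhase,
    h0, h1, U₁, U₂, U₃, U₄, hsign, waveTransform, waveTransform]
  simp only [Algebra.algebraMap_eq_smul_one, Complex.ofReal_one, Complex.ofReal_neg, one_mul,
    neg_mul, mul_neg, ← sub_eq_add_neg, sub_neg_eq_add]
  match_scalars
  · field_simp
    ring_nf
    simp only [Complex.I_sq]
    ring
  · field_simp
    ring_nf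
    simp only [Complex.I_sq]
    ring

end Laplace

end PlaneWaveSpectrum

open PlaneWaveSpectrum in
theorem mainTheorem6 (m : ℕ) (hm : 1 ≤ m) (x y : EuclideanSpace ℝ (Fin m)) :
    (∀ t : ℝ, OperatorExpConverges gammaSqExponent (planeWave x t) y) ∧
    ∀ s : ℂ, 0 < s.re →
      MeasureTheory.IntegrableOn (laplaceIntegrand (gammaSqKernel x y) s) (Set.Ioi (0 : ℝ)) ∧
      laplace (gammaSqKernel x y) s =
        (Complex.Gamma ((m : ℂ) / 2) / (4 * sqrtPlus x y s)) •
          ((1 + Complex.I) • U₁ x y s + (1 - Complex.I) • U₂ x y s +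
            Complex.exp (Complex.I * (Real.pi / 2) * ((m : ℂ) - 1) ^ 2) •
              ((1 + Complex.I) • U₃ x y s + (1 - Complex.I) • U₄ x y s)) := by
  refine ⟨operatorExpConverges x y hm, fun s hs => ⟨(hasLaplace_gammaSqKernel x y hm hs).1, ?_⟩⟩
  rcases Nat.even_or_odd m with h | h
  · exact laplace_eq_of_even x y h hm hs
  · exact laplace_eq_of_odd x y h hs
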